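/- Let $G$ be a unimodular locally compact second countable (Hausdorff) topological group with Haar measure $\mu$, and let $\mu_{n}$ be the $n$-fold product measure on $G^{n}$. Let $d$ be a left-invariant proper continuous metric on $G$ (continuous on $G\times G$, with compact closed balls). Let $G$ act on $L^2(G)=L^2(G,\mu;\mathbb C)$ by $(g\xi)(h)=\xi(g^{-1}h)$. *Continuous cohomology.* Let $C(G^{n+1},L^2(G))^G$ be the space of continuous maps $f\colon G^{n+1}\to L^2(G)$ with $g\,f(g^{-1}g_0,\dots,g^{-1}g_n)=f(g_0,\dots,g_n)$ for all $g,g_0,\dots,g_n\in G$, with the topology of compact convergence. With the differential $$(d^n f)(g_0,\dots,g_{n+1})=\sum_{i=0}^{n+1}(-1)^i f(g_0,\dots,\widehat{g_i},\dots,g_{n+1})$$ these spaces form a cochain complex. Put $H^n(G,L^2(G))=\ker d^n/\operatorname{im}d^{n-1}$ and $\underline H^n(G,L^2(G))=\ker d^n/\overline{\operatorname{im}d^{n-1}}$, where $\operatorname{im}d^{-1}=0$. *Coarse $\ell^2$-cohomology.* For $R>0$ let $G_R^{n+1}=\{(g_0,\dots,g_n)\in G^{n+1} : d(g_i,g_j)\le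 R\text{ for all }i,j\}$. Let $CX^n_{(2)}(G)$ be the space of classes, up to $\mu_{n+1}$-null sets, of measurable maps $\alpha\colon G^{n+1}\to\mathbb C$ with $\|\alpha\|_R^2=\int_{G_R^{n+1}}|\alpha|^2\,d\mu_{n+1}<\infty$ for every $R>0$, with the topology defined by the semi-norms $\|\cdot\|_R$, $R>0$. With the differential given by the same formula these spaces form a cochain complex, and $HX^n_{(2)}(G)$ and $\underline{H}X^n_{(2)}(G)$ denote its cohomology and its reduced cohomology (cocycles modulo the closure of the coboundaries). **Theorem.** For every $n\ge 0$ there are isomorphisms of complex vector spaces (in particular, of abelian groups) $$H^n(G,L^2(G))\cong HX^n_{(2)}(G),\qquad \underline H^n(G,L^2(G))\cong \underline{H}X^n_{(2)}(G).$$ Both are induced by an explicit correspondence of cocycles: for every cocycle $f\in C(G^{n+1},L^2(G))^G$ there is a cocycle $\beta\in CX^n_{(2)}(G)$ with $$f(g_0,\dots,g_n)(g)=\beta(g^{-1}g_0,\dots,g^{-1}g_n)\quad\text{for almost all }(g_0,\dots,g_n)\in G^{n+1}\text{ and almost all }g\in G,$$ and the isomorphism maps the class of $f$ to the class of $\beta$.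 -/

import Mathlib

open MeasureTheory Topology
open scoped ENNReal

noncomputable section

namespace CoarseL2

/-! ### Cohomology and reduced cohomology of a cochain complex of vector spaces -/

section Complex

variable {A : ℕ → Type*} [∀ n, AddCommGroup (A n)] [∀ n, Module ℂ (A n)]

/-- The cocycles in degree `n`: the kernel of `δ n : A n → A (n + 1)`. -/
abbrev cocycles (δ : ∀ n, A n →ₗ[ℂ] A (n + 1)) (n : ℕ) : Submodule ℂ (A n) :=
  LinearMap.ker (δ n)

/-- The coboundaries in degree `n`: the image of `δ (n - 1)`, and `0` in degree `0`. -/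
def coboundaries (δ : ∀ n, A n →ₗ[ℂ] A (n + 1)) : ∀ n, Submodule ℂ (A n)
  | 0 => ⊥
  | n + 1 => LinearMap.range (δ n)

/-- The `n`-th cohomology: cocycles modulo coboundaries. -/
abbrev Cohomology (δ : ∀ n, A n →ₗ[ℂ] A (n + 1)) (n : ℕ) : Type _ :=
  cocycles δ n ⧸ (coboundaries δ n).submoduleOf (cocycles δ n)

variable [∀ n, TopologicalSpace (A n)] [∀ n, IsTopologicalAddGroup (A n)]
  [∀ n, ContinuousConstSMul ℂ (A n)]

/-- The `n`-th reduced cohomology: cocycles modulo the closure of the coboundaries. -/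
abbrev ReducedCohomology (δ : ∀ n, A n →ₗ[ℂ] A (n + 1)) (n : ℕ) : Type _ :=
  cocycles δ n ⧸ ((coboundaries δ n).topologicalClosure).submoduleOf (cocycles δ n)

end Complex

/-- The `i`-th face map `G^{n+2} → G^{n+1}`, which omits the entry with index `i`. -/
def face {G : Type*} {n : ℕ} (i : Fin (n + 2)) (x : Fin (n + 2) → G) : Fin (n + 1) → G :=
  fun j => x (i.succAbove j)

/-! ### Continuous cohomology -/

section Continuous

variable {G : Type*} [Group G] [TopologicalSpace G] [IsTopologicalGroup G]
variable {E : Type*} [AddCommGroup E] [Module ℂ E] [TopologicalSpace E]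
  [IsTopologicalAddGroup E] [ContinuousConstSMul ℂ E]

/-- The `G`-invariants `C(G^{n+1}, E)^G` of the space of continuous functions, with respect to the
action `(g • f) x = g • f (g⁻¹ x)`, where `G` acts diagonally on `G^{n+1}`. It carries the topology
of compact convergence, i.e. the subspace topology of the compact-open topology. -/
def continuousCochains (ρ : Representation ℂ G E) (n : ℕ) :
    Submodule ℂ C(Fin (n + 1) → G, E) where
  carrier := {f | ∀ (g : G) (x : Fin (n + 1) → G), ρ g (f fun j => g⁻¹ * x j) = f x}
  add_mem' := by
    intro f f' hf hf' g x
    simp only [ContinuousMap.add_apply, map_add, hf g x, hf' g x]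
  zero_mem' := by
    intro g x
    simp
  smul_mem' := by
    intro c f hf g x
    simp only [ContinuousMap.smul_apply, map_smul, hf g x]

instance (ρ : Representation ℂ G E) (n : ℕ) :
    ContinuousConstSMul ℂ (continuousCochains ρ n) :=
  ⟨fun c => (continuous_subtype_val.const_smul c).subtype_mk _⟩

/-- The homogeneous coboundary map
`(d f)(g₀, …, g_{n+1}) = ∑ i, (-1)^i f(g₀, …, ĝᵢ, …, g_{n+1})`. -/
def continuousDifferential (ρ : Representation ℂ G E) (n : ℕ) :
    continuousCochains ρ n →ₗ[ℂ] continuousCochains ρ (n + 1) where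
  toFun f :=
    ⟨⟨fun x => ∑ i : Fin (n + 2), (-1 : ℂ) ^ (i : ℕ) • f.1 (face i x), by
        unfold face; fun_prop⟩, by
      intro g x
      simp only [ContinuousMap.coe_mk, map_sum, map_smul]
      refine Finset.sum_congr rfl fun i _ => ?_
      rw [← f.2 g (face i x)]
      rfl⟩
  map_add' f f' := by
    ext x
    simp [smul_add, Finset.sum_add_distrib]
  map_smul' c f := by
    ext x
    simp [Finset.smul_sum, smul_comm c]

/-- The continuous `n`-cocycles. -/
abbrev ContinuousCocycles (ρ : Representation ℂ G E) (n : ℕ) :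
    Submodule ℂ (continuousCochains ρ n) :=
  cocycles (continuousDifferential ρ) n

/-- The continuous cohomology `Hⁿ(G, E)`. -/
abbrev ContinuousCohomology (ρ : Representation ℂ G E) (n : ℕ) : Type _ :=
  Cohomology (continuousDifferential ρ) n

/-- The reduced continuous cohomology of `G` in `E`. -/
abbrev ReducedContinuousCohomology (ρ : Representation ℂ G E) (n : ℕ) : Type _ :=
  ReducedCohomology (continuousDifferential ρ) n

end Continuous

/-! ### The regular representation -/

section Regular

variable {G : Type*} [Group G] [MeasurableSpace G] [MeasurableMul G]

/-- The left regular representation of `G` on `L²(G) = L²(G, μ; ℂ)`, `(g • ξ)(h) = ξ(g⁻¹ h)`. -/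
def leftRegular (μ : Measure G) [μ.IsMulLeftInvariant] : Representation ℂ G (Lp ℂ 2 μ) where
  toFun g := Lp.compMeasurePreservingₗ ℂ (fun h => g⁻¹ * h) (measurePreserving_mul_left μ g⁻¹)
  map_one' := by
    ext1 ξ
    refine Lp.ext ?_
    refine (Lp.coeFn_compMeasurePreserving ξ (measurePreserving_mul_left μ 1⁻¹)).trans ?_
    simp [Function.comp_def]
  map_mul' g k := by
    ext1 ξ
    refine Lp.ext ?_
    refine (Lp.coeFn_compMeasurePreserving ξ (measurePreserving_mul_left μ (g * k)⁻¹)).trans ?_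
    refine Filter.EventuallyEq.trans ?_ (Lp.coeFn_compMeasurePreserving
      (Lp.compMeasurePreserving _ (measurePreserving_mul_left μ k⁻¹) ξ)
      (measurePreserving_mul_left μ g⁻¹)).symm
    have h := (measurePreserving_mul_left μ g⁻¹).quasiMeasurePreserving.ae_eq_comp
      (Lp.coeFn_compMeasurePreserving ξ (measurePreserving_mul_left μ k⁻¹))
    refine Filter.EventuallyEq.trans ?_ h.symm
    refine Filter.Eventually.of_forall fun x => ?_
    simp [mul_assoc]

end Regular

/-! ### Coarse `ℓ²`-cohomology -/

/-- `d` is a left-invariant proper continuous metric on the topological group `G`. -/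
structure IsProperInvariantMetric {G : Type*} [Group G] [TopologicalSpace G]
    (d : G → G → ℝ) : Prop where
  eq_zero_iff : ∀ x y, d x y = 0 ↔ x = y
  symm : ∀ x y, d x y = d y x
  triangle : ∀ x y z, d x z ≤ d x y + d y z
  continuous : Continuous fun p : G × G => d p.1 p.2
  left_invariant : ∀ g x y, d (g * x) (g * y) = d x y
  proper : ∀ (x : G) (R : ℝ), IsCompact {y | d x y ≤ R}

section Coarse

variable {G : Type*}

/-- The set `G_R^n` of all `n`-tuples in `G` whose entries have pairwise distance at most `R`. -/
def controlled (d : G → G → ℝ) (n : ℕ) (R : ℝ) : Set (Fin n → G) :=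
  {x | ∀ i j, d (x i) (x j) ≤ R}

variable [MeasurableSpace G]

/-- The space of (classes up to null sets of) measurable maps `α : G^{n+1} → ℂ` such that, for all
`R > 0`, the restriction of `α` to `G_R^{n+1}` has finite `L²`-norm `‖α‖_R`. -/
def coarseSubmodule (d : G → G → ℝ) (μ : Measure G) (n : ℕ) :
    Submodule ℂ ((Fin (n + 1) → G) →ₘ[Measure.pi fun _ => μ] ℂ) where
  carrier := {α | ∀ R : ℝ, 0 < R →
    eLpNorm α 2 ((Measure.pi fun _ => μ).restrict (controlled d (n + 1) R)) < ∞}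
  add_mem' := by
    intro α β hα hβ R hR
    rw [eLpNorm_congr_ae (ae_restrict_of_ae (AEEqFun.coeFn_add α β))]
    exact eLpNorm_add_lt_top ⟨α.aestronglyMeasurable.restrict, hα R hR⟩
      ⟨β.aestronglyMeasurable.restrict, hβ R hR⟩
  zero_mem' := by
    intro R hR
    rw [eLpNorm_congr_ae (ae_restrict_of_ae AEEqFun.coeFn_zero)]
    simp
  smul_mem' := by
    intro c α hα R hR
    rw [eLpNorm_congr_ae (ae_restrict_of_ae (AEEqFun.coeFn_smul c α)), eLpNorm_const_smul]
    exact ENNReal.mul_lt_top (by simp) (hα R hR)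

/-- The vector space `CXⁿ(G)` of coarse `ℓ²`-cochains of degree `n`. -/
def CoarseCochains (d : G → G → ℝ) (μ : Measure G) (n : ℕ) : Type _ :=
  ↥(coarseSubmodule d μ n)

instance (d : G → G → ℝ) (μ : Measure G) (n : ℕ) : AddCommGroup (CoarseCochains d μ n) :=
  inferInstanceAs (AddCommGroup ↥(coarseSubmodule d μ n))

instance (d : G → G → ℝ) (μ : Measure G) (n : ℕ) : Module ℂ (CoarseCochains d μ n) :=
  inferInstanceAs (Module ℂ ↥(coarseSubmodule d μ n))

theorem coarse_coe_add {d : G → G → ℝ} {μ : Measure G} {n : ℕ} (α β : CoarseCochains d μ n) :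
    (α + β).1 = α.1 + β.1 := rfl

theorem coarse_coe_smul {d : G → G → ℝ} {μ : Measure G} {n : ℕ} (c : ℂ)
    (α : CoarseCochains d μ n) : (c • α).1 = c • α.1 := rfl

theorem memLp_coarse {d : G → G → ℝ} {μ : Measure G} {n : ℕ} (α : CoarseCochains d μ n)
    {R : ℝ} (hR : 0 < R) :
    MemLp α.1 2 ((Measure.pi fun _ => μ).restrict (controlled d (n + 1) R)) :=
  ⟨α.1.aestronglyMeasurable.restrict, α.2 R hR⟩

/-- The seminorms `‖α‖_R = (∫_{G_R^{n+1}} |α|²)^{1/2}`, for `R > 0`. -/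
def coarseSeminorm (d : G → G → ℝ) (μ : Measure G) (n : ℕ) :
    SeminormFamily ℂ (CoarseCochains d μ n) (Set.Ioi (0 : ℝ)) := fun R =>
  Seminorm.of
    (fun α => (eLpNorm α.1 2
      ((Measure.pi fun _ => μ).restrict (controlled d (n + 1) (R : ℝ)))).toReal)
    (by
      intro α β
      rw [coarse_coe_add, eLpNorm_congr_ae (ae_restrict_of_ae (AEEqFun.coeFn_add α.1 β.1)),
        ← ENNReal.toReal_add (α.2 R R.2).ne (β.2 R R.2).ne]
      exact ENNReal.toReal_mono (ENNReal.add_ne_top.2 ⟨(α.2 R R.2).ne, (β.2 R R.2).ne⟩)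
        (eLpNorm_add_le (memLp_coarse α R.2).1 (memLp_coarse β R.2).1 (by norm_num)))
    (by
      intro c α
      rw [coarse_coe_smul, eLpNorm_congr_ae (ae_restrict_of_ae (AEEqFun.coeFn_smul c α.1)),
        eLpNorm_const_smul, ENNReal.toReal_mul]
      simp)

/-- The topology on the coarse cochains which is defined by the seminorms `‖·‖_R`, `R > 0`. -/
instance (d : G → G → ℝ) (μ : Measure G) (n : ℕ) : TopologicalSpace (CoarseCochains d μ n) :=
  (coarseSeminorm d μ n).moduleFilterBasis.topology

theorem withSeminorms_coarseSeminorm (d : G → G → ℝ) (μ : Measure G) (n : ℕ) :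
    WithSeminorms (coarseSeminorm d μ n) := ⟨rfl⟩

instance (d : G → G → ℝ) (μ : Measure G) (n : ℕ) :
    IsTopologicalAddGroup (CoarseCochains d μ n) :=
  (withSeminorms_coarseSeminorm d μ n).topologicalAddGroup

instance (d : G → G → ℝ) (μ : Measure G) (n : ℕ) :
    ContinuousSMul ℂ (CoarseCochains d μ n) :=
  (withSeminorms_coarseSeminorm d μ n).continuousSMul

theorem quasiMeasurePreserving_face (μ : Measure G) [SigmaFinite μ] {n : ℕ} (i : Fin (n + 2)) :
    Measure.QuasiMeasurePreserving (face (G := G) i)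
      (Measure.pi fun _ => μ) (Measure.pi fun _ => μ) :=
  Measure.quasiMeasurePreserving_snd.comp
    (measurePreserving_piFinSuccAbove (fun _ : Fin (n + 2) => μ) i).quasiMeasurePreserving

variable [Group G] [TopologicalSpace G] [SecondCountableTopology G] [BorelSpace G]

theorem measurableSet_controlled {d : G → G → ℝ} (hd : IsProperInvariantMetric d) (n : ℕ) (R : ℝ) :
    MeasurableSet (controlled d n R) := by
  refine IsClosed.measurableSet ?_
  simp only [controlled, Set.ofPred_forall]
  refine isClosed_iInter fun i => isClosed_iInter fun j => ?_
  exact isClosed_le (hd.continuous.comp (f := fun x : Fin n → G => (x i, x j))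
    ((continuous_apply i).prodMk (continuous_apply j))) continuous_const

variable [IsTopologicalGroup G] (μ : Measure G) [SigmaFinite μ] [μ.IsMulLeftInvariant]

theorem map_face_restrict_le {d : G → G → ℝ} (hd : IsProperInvariantMetric d) {n : ℕ}
    (i : Fin (n + 2)) (R : ℝ) :
    ((Measure.pi fun _ => μ).restrict (controlled d (n + 2) R)).map (face i) ≤
      μ {y | d 1 y ≤ R} • (Measure.pi fun _ => μ).restrict (controlled d (n + 1) R) := by
  have hface : Measurable (face (G := G) i) := (quasiMeasurePreserving_face μ i).measurable
  refine Measure.le_iff.2 fun s hs => ?_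
  have hS := hs.inter (measurableSet_controlled hd (n + 1) R)
  rw [Measure.map_apply hface hs, Measure.restrict_apply (hface hs), Measure.smul_apply,
    Measure.restrict_apply hs, smul_eq_mul]
  let T : Set (G × (Fin (n + 1) → G)) :=
    {p | d (p.2 0) p.1 ≤ R ∧ p.2 ∈ s ∩ controlled d (n + 1) R}
  have hT : MeasurableSet T := by
    refine MeasurableSet.inter ?_ (measurable_snd hS)
    exact measurableSet_le (f := fun p : G × (Fin (n + 1) → G) => d (p.2 0) p.1)
      (hd.continuous.measurable.comp
        (Measurable.prodMk (by fun_prop) measurable_fst)) measurable_const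
  have hmp := measurePreserving_piFinSuccAbove (fun _ : Fin (n + 2) => μ) i
  calc (Measure.pi fun _ => μ) (face i ⁻¹' s ∩ controlled d (n + 2) R)
      ≤ (Measure.pi fun _ => μ) (MeasurableEquiv.piFinSuccAbove (fun _ => G) i ⁻¹' T) := by
        refine measure_mono fun x hx => ⟨hx.2 _ _, hx.1, fun _ _ => hx.2 _ _⟩
    _ = (μ.prod (Measure.pi fun _ => μ)) T := hmp.measure_preimage hT.nullMeasurableSet
    _ = ∫⁻ y, μ ((fun t => (t, y)) ⁻¹' T) ∂(Measure.pi fun _ => μ) :=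
        Measure.prod_apply_symm hT
    _ ≤ ∫⁻ y, (s ∩ controlled d (n + 1) R).indicator (fun _ => μ {y | d 1 y ≤ R}) y
          ∂(Measure.pi fun _ => μ) := by
        refine lintegral_mono fun y => ?_
        by_cases hy : y ∈ s ∩ controlled d (n + 1) R
        · rw [Set.indicator_of_mem hy, ← measure_preimage_mul μ (y 0)⁻¹ {y | d 1 y ≤ R}]
          refine measure_mono fun t ht => ?_
          have h := hd.left_invariant (y 0)⁻¹ (y 0) t
          rw [inv_mul_cancel] at h
          simpa [h] using ht.1
        · rw [Set.indicator_of_notMem hy]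
          refine le_of_eq (measure_mono_null (t := ∅) (fun t ht => hy ht.2) measure_empty)
    _ = _ := by rw [lintegral_indicator_const hS]

variable [IsFiniteMeasureOnCompacts μ]

/-- Pull-back of coarse cochains along the `i`-th face map. -/
def coarseFace {d : G → G → ℝ} (hd : IsProperInvariantMetric d) {n : ℕ} (i : Fin (n + 2)) :
    CoarseCochains d μ n →ₗ[ℂ] CoarseCochains d μ (n + 1) where
  toFun α := ⟨α.1.compQuasiMeasurePreserving (face i) (quasiMeasurePreserving_face μ i), by
    intro R hR
    have hmap := map_face_restrict_le μ hd i R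
    have hfin : μ {y | d 1 y ≤ R} ≠ ∞ := (hd.proper 1 R).measure_lt_top.ne
    have hmem : MemLp α.1 2
        (((Measure.pi fun _ => μ).restrict (controlled d (n + 2) R)).map (face i)) :=
      ((memLp_coarse α hR).smul_measure hfin).mono_measure hmap
    rw [eLpNorm_congr_ae (ae_restrict_of_ae (AEEqFun.coeFn_compQuasiMeasurePreserving α.1
      (quasiMeasurePreserving_face μ i))), ← eLpNorm_map_measure hmem.1
      (quasiMeasurePreserving_face μ i).measurable.aemeasurable]
    exact hmem.2⟩
  map_add' α β := by
    rcases α with ⟨⟨_⟩, _⟩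
    rcases β with ⟨⟨_⟩, _⟩
    rfl
  map_smul' c α := by
    rcases α with ⟨⟨_⟩, _⟩
    rfl

/-- The homogeneous coboundary map
`(d α)(g₀, …, g_{n+1}) = ∑ i, (-1)^i α(g₀, …, ĝᵢ, …, g_{n+1})` on coarse cochains. -/
def coarseDifferential {d : G → G → ℝ} (hd : IsProperInvariantMetric d) (n : ℕ) :
    CoarseCochains d μ n →ₗ[ℂ] CoarseCochains d μ (n + 1) :=
  ∑ i : Fin (n + 2), (-1 : ℂ) ^ (i : ℕ) • coarseFace μ hd i

/-- The coarse `n`-cocycles. -/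
abbrev CoarseCocycles {d : G → G → ℝ} (hd : IsProperInvariantMetric d) (n : ℕ) :
    Submodule ℂ (CoarseCochains d μ n) :=
  cocycles (coarseDifferential μ hd) n

/-- The coarse `ℓ²`-cohomology of `G`. -/
abbrev CoarseCohomology {d : G → G → ℝ} (hd : IsProperInvariantMetric d) (n : ℕ) : Type _ :=
  Cohomology (coarseDifferential μ hd) n

/-- The reduced coarse `ℓ²`-cohomology of `G`. -/
abbrev ReducedCoarseCohomology {d : G → G → ℝ} (hd : IsProperInvariantMetric d) (n : ℕ) :
    Type _ :=
  ReducedCohomology (coarseDifferential μ hd) n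

end Coarse

/-- The cochains `f : G^{n+1} → L²(G)` and `β : G^{n+1} → ℂ` correspond to each other:
`f(g₀, …, gₙ)(g) = β(g⁻¹g₀, …, g⁻¹gₙ)` for almost all `(g₀, …, gₙ)` and almost all `g`. -/
def Corresponds {G : Type*} [Group G] [TopologicalSpace G] [MeasurableSpace G] {μ : Measure G}
    {n : ℕ} (f : C(Fin (n + 1) → G, Lp ℂ 2 μ))
    (β : (Fin (n + 1) → G) →ₘ[Measure.pi fun _ => μ] ℂ) : Prop :=
  ∀ᵐ x ∂(Measure.pi fun _ : Fin (n + 1) => μ), ∀ᵐ g ∂μ, f x g = β fun j => g⁻¹ * x j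

end CoarseL2

end

open CoarseL2

/-!
An invariant cochain `f` satisfies `f(x)(g) = f(g⁻¹x)(1)` formally, so it is determined by the
function `β` with `f(x)(g) = β(g⁻¹x)`. Since a vector of `L²(G)` has no value at a point, `β` is
obtained from the kernel `(x, g) ↦ f(gx)(g)` instead: invariance makes it essentially independent
of `g`. The translates of the relatively compact set `controlledNearOne` cover the controlled
tuples evenly, because `G` is unimodular, so `∫ ‖β‖²` over the controlled tuples is bounded by the
supremum of `‖f‖²` over a compact set (`Corresponds.setLIntegral_le`). This is the injective
continuous chain map `toCoarse` (`corresponds_toCoarse`, `continuous_toCoarse`).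

The correspondent of a coarse cochain is in general only measurable in `x`, and is made continuous
by smoothing. Let `χ` be a continuous function with compact support and integral one. The cochain
`∫ χ(x₀⁻¹y₀) ⋯ χ(xₙ⁻¹yₙ) β(g⁻¹y) dy`, as a function of `g`, lies in `L²(G)`, depends continuously
on `x`, and is invariant (`fromCoarse`, `continuous_fromCoarse`). This gives a continuous chain
map in the other direction.

Both composites are given by smoothing with the weight `∏ χ(xᵢ⁻¹yᵢ)`. On cocycles, smoothing is
homotopic to the identity by the integral over `y` of the prism operators between the simplices
`x` and `y` (`altSum_prism_add_prism_altSum`, `altSum_smoothedPrism`). For continuous cochains the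
integrand is continuous with compact support (`fromCoarse_toCoarse_sub_mem`). For coarse cochains
the prisms over a controlled simplex are controlled where the weight does not vanish, and the
Cauchy-Schwarz inequality shows that the homotopy is a coarse cochain
(`toCoarse_fromCoarse_sub_mem`). Hence the chain maps induce inverse isomorphisms in cohomology,
and in reduced cohomology because they are continuous.
-/

open MeasureTheory Topology
open scoped ENNReal

set_option linter.unusedSectionVars false

noncomputable section

namespace CoarseL2

/-! ### The prism identity -/

section Prism

variable {T E : Type*} [AddCommGroup E] [Module ℂ E]

/-- The alternating sum `∑ i, (-1)^i f(x₀, …, x̂ᵢ, …, xₙ)`, for a function `f` of `n` variables,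
where `n = 0` is allowed. -/
def altSum {n : ℕ} (f : (Fin n → T) → E) (x : Fin (n + 1) → T) : E :=
  ∑ i : Fin (n + 1), (-1 : ℂ) ^ (i : ℕ) • f fun j => x (i.succAbove j)

/-- The indices of the vertices `x₀, …, xᵢ, zᵢ, …, z_{n-1}` of the `i`-th simplex of the prism over
an `(n-1)`-simplex: `Sum.inl` points to the bottom `x`, and `Sum.inr` to the top `z`. -/
def prismIndex {n : ℕ} (i : Fin n) (j : Fin (n + 1)) : Fin n ⊕ Fin n :=
  if i.castSucc < j then Sum.inr (i.predAbove j) else Sum.inl (i.predAbove j)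

/-- The vertices `x₀, …, xᵢ, zᵢ, …, z_{n-1}` of the `i`-th simplex of a prism. -/
def prismVertex {n : ℕ} (i : Fin n) (x z : Fin n → T) : Fin (n + 1) → T :=
  fun j => Sum.elim x z (prismIndex i j)

/-- The prism operator `∑ i, (-1)^i f(x₀, …, xᵢ, zᵢ, …, z_{n-1})`. -/
def prism {n : ℕ} (f : (Fin (n + 1) → T) → E) (x z : Fin n → T) : E :=
  ∑ i : Fin n, (-1 : ℂ) ^ (i : ℕ) • f (prismVertex i x z)

theorem prismIndex_injective {n : ℕ} (i : Fin n) : Function.Injective (prismIndex i) := by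
  intro j k h
  unfold prismIndex at h
  split_ifs at h with hj hk hk
  · have h' := Sum.inr_injective h
    rw [Fin.predAbove_of_castSucc_lt _ _ hj, Fin.predAbove_of_castSucc_lt _ _ hk] at h'
    exact Fin.pred_inj.1 h'
  · have h' := Sum.inl_injective h
    rw [Fin.predAbove_of_le_castSucc _ _ (not_lt.1 hj),
      Fin.predAbove_of_le_castSucc _ _ (not_lt.1 hk)] at h'
    exact Fin.castPred_inj.1 h'

theorem prismIndex_apply_zero {n : ℕ} (i : Fin (n + 1)) : prismIndex i 0 = Sum.inl 0 := by
  simp [prismIndex]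

theorem prismVertex_zero_cons {n : ℕ} (a c : T) (x z : Fin n → T) :
    prismVertex 0 (Fin.cons a x : Fin (n + 1) → T) (Fin.cons c z) = Fin.cons a (Fin.cons c z) := by
  funext j
  refine Fin.cases ?_ (fun j => ?_) j
  · simp [prismVertex, prismIndex]
  · simp [prismVertex, prismIndex]

theorem prismVertex_succ_cons {n : ℕ} (i : Fin n) (a c : T) (x z : Fin n → T) :
    prismVertex i.succ (Fin.cons a x : Fin (n + 1) → T) (Fin.cons c z) =
      Fin.cons a (prismVertex i x z) := by
  funext j
  refine Fin.cases ?_ (fun j => ?_) j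
  · simp [prismVertex, prismIndex]
  · simp only [prismVertex, prismIndex, Fin.cons_succ, Fin.succ_predAbove_succ,
      ← Fin.succ_castSucc, Fin.succ_lt_succ_iff]
    split_ifs <;> simp

theorem altSum_cons {n : ℕ} (f : (Fin (n + 1) → T) → E) (a : T) (x : Fin (n + 1) → T) :
    altSum f (Fin.cons a x : Fin (n + 2) → T) =
      f x - altSum (fun y : Fin n → T => f (Fin.cons a y)) x := by
  have h : ∀ i : Fin (n + 1), (fun j => (Fin.cons a x : Fin (n + 2) → T) (i.succ.succAbove j)) =
      (Fin.cons a (fun j => x (i.succAbove j)) : Fin (n + 1) → T) := by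
    intro i
    funext j
    refine Fin.cases ?_ (fun j => ?_) j <;> simp
  simp only [altSum]
  rw [Fin.sum_univ_succ]
  simp [h, pow_succ, Finset.sum_neg_distrib, sub_eq_add_neg]

theorem prism_cons {n : ℕ} (f : (Fin (n + 2) → T) → E) (a c : T) (x z : Fin n → T) :
    prism f (Fin.cons a x : Fin (n + 1) → T) (Fin.cons c z) =
      f (Fin.cons a (Fin.cons c z)) - prism (fun y : Fin (n + 1) → T => f (Fin.cons a y)) x z := by
  simp only [prism]
  rw [Fin.sum_univ_succ]
  simp [prismVertex_zero_cons, prismVertex_succ_cons, pow_succ, Finset.sum_neg_distrib,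
    sub_eq_add_neg]

theorem altSum_sub {n : ℕ} (f f' : (Fin n → T) → E) (x : Fin (n + 1) → T) :
    altSum (fun y => f y - f' y) x = altSum f x - altSum f' x := by
  simp [altSum, smul_sub, Finset.sum_sub_distrib]

theorem prism_sub {n : ℕ} (f f' : (Fin (n + 1) → T) → E) (x z : Fin n → T) :
    prism (fun y => f y - f' y) x z = prism f x z - prism f' x z := by
  simp [prism, smul_sub, Finset.sum_sub_distrib]

/-- The prism operator is a chain homotopy between the restrictions to the bottom and to the top of
the prism. The first summand is the coboundary of the prism operator, for pairs of tuples viewed as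
tuples of pairs. -/
theorem altSum_prism_add_prism_altSum {n : ℕ} (f : (Fin (n + 1) → T) → E) (x z : Fin (n + 1) → T) :
    altSum (fun p : Fin n → T × T => prism f (fun i => (p i).1) (fun i => (p i).2))
        (fun i => (x i, z i)) + prism (altSum f) x z = f z - f x := by
  induction n with
  | zero =>
    have h₀ : (fun j : Fin 1 => prismVertex 0 x z j.succ) = z := by
      funext j
      simp [Subsingleton.elim j 0, prismVertex, prismIndex]
    have h₁ : (fun j : Fin 1 => prismVertex 0 x z ((1 : Fin 2).succAbove j)) = x := by
      funext j
      simp [Subsingleton.elim j 0, prismVertex, prismIndex]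
    simp [altSum, prism, Fin.sum_univ_two, h₀, h₁, sub_eq_add_neg]
  | succ n ih =>
    obtain ⟨a, x, rfl⟩ : ∃ a y, x = Fin.cons a y := ⟨x 0, Fin.tail x, (Fin.cons_self_tail x).symm⟩
    obtain ⟨c, z, rfl⟩ : ∃ a y, z = Fin.cons a y := ⟨z 0, Fin.tail z, (Fin.cons_self_tail z).symm⟩
    have hp : (fun i => ((Fin.cons a x : Fin (n + 2) → T) i, (Fin.cons c z : Fin (n + 2) → T) i)) =
        (Fin.cons (a, c) (fun i => (x i, z i)) : Fin (n + 2) → T × T) := by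
      funext i
      refine Fin.cases ?_ (fun i => ?_) i <;> simp
    have h₁ : ∀ p : Fin n → T × T, (fun i => ((Fin.cons (a, c) p : Fin (n + 1) → T × T) i).1) =
        (Fin.cons a (fun i => (p i).1) : Fin (n + 1) → T) := by
      intro p
      funext i
      refine Fin.cases ?_ (fun i => ?_) i <;> simp
    have h₂ : ∀ p : Fin n → T × T, (fun i => ((Fin.cons (a, c) p : Fin (n + 1) → T × T) i).2) =
        (Fin.cons c (fun i => (p i).2) : Fin (n + 1) → T) := by
      intro p
      funext i
      refine Fin.cases ?_ (fun i => ?_) i <;> simp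
    have hz : altSum (fun p : Fin n → T × T => f (Fin.cons a (Fin.cons c fun i => (p i).2)))
        (fun i => (x i, z i)) = altSum (fun y : Fin n → T => f (Fin.cons a (Fin.cons c y))) z := rfl
    rw [hp, altSum_cons, prism_cons]
    simp only [h₁, h₂, prism_cons, altSum_cons, altSum_sub, prism_sub, hz]
    have := ih (fun y => f (Fin.cons a y)) x z
    rw [eq_sub_iff_add_eq] at this ⊢
    rw [← this]
    abel

end Prism

/-! ### Measure-theoretic preliminaries -/

section MeasureTheory

theorem sq_lintegral_mul_le {Y : Type*} [MeasurableSpace Y] {ν : Measure Y} {f g : Y → ℝ≥0∞}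
    (hf : AEMeasurable f ν) (hg : AEMeasurable g ν) :
    (∫⁻ y, f y * g y ∂ν) ^ 2 ≤ (∫⁻ y, f y ^ 2 ∂ν) * ∫⁻ y, g y ^ 2 ∂ν := by
  have h := ENNReal.lintegral_mul_le_Lp_mul_Lq ν Real.HolderConjugate.two_two hf hg
  have h' := pow_le_pow_left' h 2
  refine h'.trans (le_of_eq ?_)
  simp only [mul_pow, ← ENNReal.rpow_natCast, ← ENNReal.rpow_mul]
  norm_num

/-- The Cauchy–Schwarz inequality for an integral against a weight `k` which vanishes outside of
`S`. -/
theorem sq_enorm_integral_smul_le {Y E : Type*} [MeasurableSpace Y] [NormedAddCommGroup E]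
    [NormedSpace ℝ E] {ν : Measure Y} {k : Y → ℝ} {b : Y → E} {S : Set Y}
    (hk : AEMeasurable k ν) (hb : AEStronglyMeasurable b ν) (hkS : ∀ y ∉ S, k y = 0) :
    ‖∫ y, k y • b y ∂ν‖ₑ ^ 2 ≤ (∫⁻ y in S, ‖k y‖ₑ ^ 2 ∂ν) * ∫⁻ y in S, ‖b y‖ₑ ^ 2 ∂ν := by
  rw [← setIntegral_eq_integral_of_forall_compl_eq_zero (s := S) fun y hy => by simp [hkS y hy]]
  refine (pow_le_pow_left' (enorm_integral_le_lintegral_enorm _) 2).trans ?_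
  simp only [enorm_smul]
  exact sq_lintegral_mul_le hk.enorm.restrict hb.enorm.restrict

theorem eLpNorm_two_sq {Y E : Type*} [MeasurableSpace Y] [NormedAddCommGroup E] (ν : Measure Y)
    (b : Y → E) : eLpNorm b 2 ν ^ 2 = ∫⁻ y, ‖b y‖ₑ ^ 2 ∂ν := by
  have := eLpNorm_nnreal_pow_eq_lintegral (f := b) (μ := ν) (p := 2) two_ne_zero
  simpa using this

section Coordinates

variable {G ι κ : Type*} [MeasurableSpace G] (μ : Measure G) [SigmaFinite μ] [Fintype ι]
  [Fintype κ]

open Classical in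
/-- A choice of some of the coordinates splits a product measure. -/
theorem measurePreserving_comp_injective {e : ι → κ} (he : Function.Injective e) :
    MeasurePreserving
      (fun y : κ → G => (fun i => y (e i), fun k : {k // k ∉ Set.range e} => y k))
      (Measure.pi fun _ => μ) ((Measure.pi fun _ => μ).prod (Measure.pi fun _ => μ)) := by
  have h₁ := measurePreserving_piEquivPiSubtypeProd (fun _ : κ => μ) (· ∈ Set.range e)
  have h₂ := (@measurePreserving_piCongrLeft _ _ (fun _ : {k // k ∈ Set.range e} => G)
    (Subtype.fintype _) _ (fun _ => μ) _ _ (Equiv.ofInjective e he)).symm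
  have h₃ := (h₂.prod (MeasurePreserving.id
    (Measure.pi fun _ : {k // k ∉ Set.range e} => μ))).comp h₁
  exact h₃

theorem quasiMeasurePreserving_comp_injective {e : ι → κ} (he : Function.Injective e) :
    Measure.QuasiMeasurePreserving (fun (y : κ → G) i => y (e i))
      (Measure.pi fun _ => μ) (Measure.pi fun _ => μ) :=
  Measure.quasiMeasurePreserving_fst.comp
    (measurePreserving_comp_injective μ he).quasiMeasurePreserving

end Coordinates

/-- A continuous map to `L²` has a jointly measurable version: it is a pointwise limit of maps with
countably many values, and the convergence is fast enough to be almost everywhere. -/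
theorem exists_measurable_uncurry {Y G : Type*} [TopologicalSpace Y] [SecondCountableTopology Y]
    [MeasurableSpace Y] [BorelSpace Y] [MeasurableSpace G] {μ : Measure G} {f : Y → Lp ℂ 2 μ}
    (hf : Continuous f) :
    ∃ F : Y × G → ℂ, Measurable F ∧ ∀ y, ∀ᵐ g ∂μ, F (y, g) = f y g := by
  classical
  rcases isEmpty_or_nonempty Y with hY | hY
  · exact ⟨0, measurable_const, fun y => isEmptyElim y⟩
  let s := TopologicalSpace.denseSeq Y
  let ε : ℕ → ℝ := fun k => (1 / 4) ^ (k + 1)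
  have hε : ∀ k, 0 < ε k := fun k => by positivity
  have hex : ∀ k y, ∃ j, ‖f (s j) - f y‖ < ε k := by
    intro k y
    have hU : IsOpen {x | ‖f x - f y‖ < ε k} :=
      isOpen_lt (hf.sub continuous_const).norm continuous_const
    obtain ⟨x, hx, j, rfl⟩ :=
      (TopologicalSpace.denseRange_denseSeq Y).inter_open_nonempty _ hU ⟨y, by simpa using hε k⟩
    exact ⟨j, hx⟩
  let N : ℕ → Y → ℕ := fun k y => Nat.find (hex k y)
  have hN : ∀ k, Measurable (N k) := fun k => measurable_find (hex k) fun j =>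
    (isOpen_lt (continuous_const.sub hf).norm continuous_const).measurableSet
  have hNs : ∀ k y, ‖f (s (N k y)) - f y‖ < ε k := fun k y => Nat.find_spec (hex k y)
  let F : ℕ → Y × G → ℂ := fun k p => f (s (N k p.1)) p.2
  have hF : ∀ k, Measurable (F k) := by
    intro k
    have h : Measurable fun p : ℕ × G => (f (s p.1) : G → ℂ) p.2 :=
      measurable_from_prod_countable_right fun j => (Lp.stronglyMeasurable (f (s j))).measurable
    exact h.comp (((hN k).comp measurable_fst).prodMk measurable_snd)
  refine ⟨fun p => Filter.atTop.limUnder fun k => F k p,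
    (StronglyMeasurable.limUnder fun k => (hF k).stronglyMeasurable).measurable, fun y => ?_⟩
  -- the approximations at `y`, as a fast Cauchy sequence in `L²`
  have hmeas : ∀ k, AEStronglyMeasurable (f (s (N k y)) : G → ℂ) μ :=
    fun k => (Lp.stronglyMeasurable _).aestronglyMeasurable
  have hsub : ∀ ξ η : Lp ℂ 2 μ, eLpNorm ((ξ : G → ℂ) - (η : G → ℂ)) 2 μ = ‖ξ - η‖ₑ := by
    intro ξ η
    rw [Lp.enorm_def, eLpNorm_congr_ae (Lp.coeFn_sub ξ η)]
  have hB : ∑' k, ENNReal.ofReal ((1 / 2) ^ k) ≠ ∞ := by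
    rw [← ENNReal.ofReal_tsum_of_nonneg (fun k => by positivity) summable_geometric_two]
    exact ENNReal.ofReal_ne_top
  have hcau : ∀ K n m : ℕ, K ≤ n → K ≤ m →
      eLpNorm ((f (s (N n y)) : G → ℂ) - (f (s (N m y)) : G → ℂ)) 2 μ
        < ENNReal.ofReal ((1 / 2) ^ K) := by
    intro K n m hn hm
    rw [hsub, ← ofReal_norm]
    refine (ENNReal.ofReal_lt_ofReal_iff (by positivity)).2 ?_
    have hle : ∀ k, K ≤ k → ε k ≤ (1 / 4) * (1 / 2) ^ K := by
      intro k hk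
      have h₁ : ((1 : ℝ) / 4) ^ k ≤ (1 / 4) ^ K :=
        pow_le_pow_of_le_one (by norm_num) (by norm_num) hk
      have h₂ : ((1 : ℝ) / 4) ^ K ≤ (1 / 2) ^ K := by gcongr; norm_num
      simp only [ε, pow_succ]
      linarith
    have hpos : (0 : ℝ) < (1 / 2) ^ K := by positivity
    calc ‖f (s (N n y)) - f (s (N m y))‖
        = ‖(f (s (N n y)) - f y) - (f (s (N m y)) - f y)‖ := by rw [sub_sub_sub_cancel_right]
      _ ≤ _ := norm_sub_le _ _
      _ < (1 / 2) ^ K := by linarith [hNs n y, hNs m y, hle n hn, hle m hm]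
  have hlim := Lp.ae_tendsto_of_cauchy_eLpNorm hmeas (by norm_num) hB hcau
  let ℓ : G → ℂ := fun g => Filter.atTop.limUnder fun k => F k (y, g)
  have hℓ : ∀ᵐ g ∂μ, Filter.Tendsto (fun k => (f (s (N k y)) : G → ℂ) g) Filter.atTop (𝓝 (ℓ g)) :=
    hlim.mono fun g hg => tendsto_nhds_limUnder hg
  have hconv := Lp.cauchy_tendsto_of_tendsto hmeas ℓ hB hcau hℓ
  have hℓm : AEStronglyMeasurable ℓ μ :=
    aestronglyMeasurable_of_tendsto_ae _ hmeas hℓ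
  have hconv' : Filter.Tendsto (fun k => eLpNorm ((f (s (N k y)) : G → ℂ) - (f y : G → ℂ)) 2 μ)
      Filter.atTop (𝓝 0) := by
    simp only [hsub, ← ofReal_norm]
    rw [← ENNReal.ofReal_zero]
    refine (ENNReal.continuous_ofReal.tendsto _).comp ?_
    refine squeeze_zero (fun _ => norm_nonneg _) (fun k => (hNs k y).le) ?_
    exact (tendsto_pow_atTop_nhds_zero_of_lt_one (by norm_num) (by norm_num)).comp
      (Filter.tendsto_add_atTop_nat 1)
  have hzero : eLpNorm (ℓ - (f y : G → ℂ)) 2 μ = 0 := by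
    refine le_antisymm ?_ zero_le
    have hadd := hconv.add hconv'
    rw [add_zero] at hadd
    refine ge_of_tendsto' hadd fun k => ?_
    have hrw : ℓ - (f y : G → ℂ) = ((f (s (N k y)) : G → ℂ) - (f y : G → ℂ)) -
        ((f (s (N k y)) : G → ℂ) - ℓ) := by abel
    rw [hrw, add_comm]
    exact eLpNorm_sub_le ((hmeas k).sub (Lp.stronglyMeasurable _).aestronglyMeasurable)
      ((hmeas k).sub hℓm) (by norm_num)
  rw [eLpNorm_eq_zero_iff (hℓm.sub (Lp.stronglyMeasurable _).aestronglyMeasurable)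
    (by norm_num)] at hzero
  filter_upwards [hzero] with g hg
  exact sub_eq_zero.1 hg

/-- The Bochner integral of a map to `L²` can be computed pointwise. -/
theorem coeFn_integral_ae {Y G : Type*} [MeasurableSpace Y] [MeasurableSpace G] {ν : Measure Y}
    [SigmaFinite ν] {μ : Measure G} [SigmaFinite μ] {f : Y → Lp ℂ 2 μ} (hf : Integrable f ν)
    {F : Y × G → ℂ} (hF : Measurable F) (h : ∀ᵐ y ∂ν, ∀ᵐ g ∂μ, F (y, g) = f y g) :
    ∀ᵐ g ∂μ, (∫ y, f y ∂ν : Lp ℂ 2 μ) g = ∫ y, F (y, g) ∂ν := by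
  -- integrability over the product with a set of finite measure
  have hint : ∀ s, MeasurableSet s → μ s < ∞ → Integrable F (ν.prod (μ.restrict s)) := by
    intro s hs hμs
    have : IsFiniteMeasure (μ.restrict s) := ⟨by simpa using hμs⟩
    refine ⟨hF.aestronglyMeasurable, ?_⟩
    have hle : ∀ᵐ y ∂ν, ∫⁻ g in s, ‖F (y, g)‖ₑ ∂μ ≤ ‖f y‖ₑ * μ s ^ (1 / 2 : ℝ) := by
      filter_upwards [h] with y hy
      have h₁ := eLpNorm_le_eLpNorm_mul_rpow_measure_univ (μ := μ.restrict s) (f := f y)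
        (p := 1) (q := 2) (by norm_num) (Lp.stronglyMeasurable _).aestronglyMeasurable
      rw [eLpNorm_one_eq_lintegral_enorm] at h₁
      have h₂ : ∫⁻ g in s, ‖F (y, g)‖ₑ ∂μ = ∫⁻ g in s, ‖f y g‖ₑ ∂μ :=
        lintegral_congr_ae (ae_restrict_of_ae (hy.mono fun g hg => congrArg _ hg))
      rw [h₂]
      refine h₁.trans ?_
      rw [Lp.enorm_def]
      rw [Measure.restrict_apply_univ, ENNReal.toReal_one, ENNReal.toReal_ofNat]
      norm_num only
      exact mul_le_mul_left (eLpNorm_mono_measure _ Measure.restrict_le_self) _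
    rw [hasFiniteIntegral_iff_enorm, lintegral_prod _ hF.enorm.aemeasurable]
    refine (lintegral_mono_ae hle).trans_lt ?_
    rw [lintegral_mul_const'' _ hf.1.enorm]
    exact ENNReal.mul_lt_top hf.2 (ENNReal.rpow_lt_top_of_nonneg (by norm_num) hμs.ne)
  have hint' : ∀ (ξ : Lp ℂ 2 μ) s, MeasurableSet s → μ s < ∞ → IntegrableOn ξ s μ :=
    fun ξ s hs hμs => integrableOn_Lp_of_measure_ne_top ξ (by norm_num) hμs.ne
  refine ae_eq_of_forall_setIntegral_eq_of_sigmaFinite (hint' _)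
    (fun s hs hμs => (hint s hs hμs).integral_prod_right) fun s hs hμs => ?_
  rw [← integral_integral_swap (f := fun y g => F (y, g)) (hint s hs hμs)]
  -- integration over `s` is a continuous linear functional on `L²`
  have hL : ∀ ξ : Lp ℂ 2 μ, ∫ g in s, ξ g ∂μ =
      inner ℂ (indicatorConstLp 2 hs hμs.ne (1 : ℂ)) ξ := by
    intro ξ
    rw [L2.inner_indicatorConstLp_one]
  rw [hL, ← integral_inner hf]
  refine integral_congr_ae ?_
  filter_upwards [h] with y hy
  rw [← hL]
  exact integral_congr_ae (ae_restrict_of_ae (hy.mono fun g hg => hg.symm))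

end MeasureTheory

/-! ### Integration over orbits -/

section Orbits

variable {G : Type*} [Group G] [TopologicalSpace G] [IsTopologicalGroup G]
  [LocallyCompactSpace G] [SecondCountableTopology G] [MeasurableSpace G] [BorelSpace G]
  {μ : Measure G} [μ.IsHaarMeasure] {d : G → G → ℝ} {ι : Type*} [Fintype ι]

theorem measurePreserving_diagonal_mul (g : G) :
    MeasurePreserving (fun (x : ι → G) j => g * x j)
      (Measure.pi fun _ => μ) (Measure.pi fun _ => μ) :=
  measurePreserving_mul_left (Measure.pi fun _ : ι => μ) fun _ => g

theorem measurable_inv_diagonal_mul :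
    Measurable fun (p : (ι → G) × G) (j : ι) => p.2⁻¹ * p.1 j := by fun_prop

theorem quasiMeasurePreserving_inv_diagonal_mul :
    Measure.QuasiMeasurePreserving (fun (p : (ι → G) × G) (j : ι) => p.2⁻¹ * p.1 j)
      ((Measure.pi fun _ => μ).prod μ) (Measure.pi fun _ => μ) := by
  refine ⟨measurable_inv_diagonal_mul, Measure.AbsolutelyContinuous.mk fun s hs h0 => ?_⟩
  rw [Measure.map_apply measurable_inv_diagonal_mul hs,
    Measure.prod_apply_symm (measurable_inv_diagonal_mul hs)]
  refine (lintegral_congr fun g => ?_).trans lintegral_zero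
  exact ((measurePreserving_diagonal_mul g⁻¹).measure_preimage hs.nullMeasurableSet).trans h0

theorem ae_ae_inv_diagonal_mul {p : (ι → G) → Prop} (hp : ∀ᵐ x ∂(Measure.pi fun _ => μ), p x) :
    ∀ᵐ x ∂(Measure.pi fun _ : ι => μ), ∀ᵐ g ∂μ, p fun j => g⁻¹ * x j :=
  Measure.ae_ae_of_ae_prod (quasiMeasurePreserving_inv_diagonal_mul.ae hp)

theorem ae_of_ae_ae_inv_diagonal_mul {p : (ι → G) → Prop} (hpm : MeasurableSet {x | p x})
    (hp : ∀ᵐ x ∂(Measure.pi fun _ : ι => μ), ∀ᵐ g ∂μ, p fun j => g⁻¹ * x j) :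
    ∀ᵐ x ∂(Measure.pi fun _ => μ), p x := by
  rw [Measure.ae_ae_comm (p := fun (x : ι → G) g => p fun j => g⁻¹ * x j)
    (measurable_inv_diagonal_mul hpm)] at hp
  obtain ⟨g, hg⟩ := hp.exists
  have h := (measurePreserving_diagonal_mul (ι := ι) (μ := μ) g).quasiMeasurePreserving.ae hg
  simpa using h

/-- Integration over `L`, followed by integration over the orbits of `G`, amounts to a weight that
measures how often the orbit of a tuple meets `L`. -/
theorem lintegral_setLIntegral_inv_diagonal_mul {φ : (ι → G) → ℝ≥0∞} (hφ : Measurable φ)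
    {L : Set (ι → G)} (hL : MeasurableSet L) :
    ∫⁻ g, ∫⁻ x in L, φ (fun j => g⁻¹ * x j) ∂(Measure.pi fun _ => μ) ∂μ =
      ∫⁻ w, φ w * μ {g | (fun j => g * w j) ∈ L} ∂(Measure.pi fun _ => μ) := by
  have hm : Measurable fun p : G × (ι → G) => fun j => p.1 * p.2 j := by fun_prop
  have h₁ : ∀ g : G, ∫⁻ x in L, φ (fun j => g⁻¹ * x j) ∂(Measure.pi fun _ => μ) =
      ∫⁻ w, φ w * L.indicator 1 (fun j => g * w j) ∂(Measure.pi fun _ => μ) := by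
    intro g
    have hφg : Measurable fun x : ι → G => φ fun j => g⁻¹ * x j := hφ.comp (by fun_prop)
    rw [← lintegral_indicator hL,
      ← (measurePreserving_diagonal_mul g).lintegral_comp (hφg.indicator hL)]
    refine lintegral_congr fun w => ?_
    by_cases hw : (fun j => g * w j) ∈ L <;> simp [hw]
  have hmeas : Measurable fun p : G × (ι → G) => φ p.2 * L.indicator 1 (fun j => p.1 * p.2 j) :=
    (hφ.comp measurable_snd).mul ((measurable_one.indicator hL).comp hm)
  simp only [h₁]
  rw [lintegral_lintegral_swap hmeas.aemeasurable]
  refine lintegral_congr fun w => ?_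
  have hLw : MeasurableSet {g | (fun j => g * w j) ∈ L} :=
    (by fun_prop : Measurable fun g : G => fun j => g * w j) hL
  have hLw' : Measurable fun g : G => L.indicator (1 : (ι → G) → ℝ≥0∞) fun j => g * w j :=
    (measurable_one.indicator hL).comp (by fun_prop)
  rw [lintegral_const_mul _ hLw', ← lintegral_indicator_one hLw]
  rfl

theorem setLIntegral_lintegral_inv_diagonal_mul {φ : (ι → G) → ℝ≥0∞} (hφ : Measurable φ)
    {L : Set (ι → G)} (hL : MeasurableSet L) :
    ∫⁻ x in L, ∫⁻ g, φ (fun j => g⁻¹ * x j) ∂μ ∂(Measure.pi fun _ => μ) =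
      ∫⁻ w, φ w * μ {g | (fun j => g * w j) ∈ L} ∂(Measure.pi fun _ => μ) := by
  rw [← lintegral_setLIntegral_inv_diagonal_mul hφ hL]
  exact lintegral_lintegral_swap (hφ.comp measurable_inv_diagonal_mul).aemeasurable

/-- The closed ball of radius `r` around the identity, with respect to `d`. -/
abbrev ballOne (d : G → G → ℝ) (r : ℝ) : Set G := {y | d 1 y ≤ r}

theorem IsProperInvariantMetric.self_eq_zero (hd : IsProperInvariantMetric d) (x : G) :
    d x x = 0 := (hd.eq_zero_iff x x).2 rfl

theorem IsProperInvariantMetric.measurableSet_ballOne (hd : IsProperInvariantMetric d) (r : ℝ) :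
    MeasurableSet (ballOne d r) :=
  (isClosed_le (hd.continuous.comp (continuous_const.prodMk continuous_id))
    continuous_const).measurableSet

theorem IsProperInvariantMetric.measure_ballOne_lt_top (hd : IsProperInvariantMetric d) (r : ℝ) :
    μ (ballOne d r) < ∞ := (hd.proper 1 r).measure_lt_top

theorem IsProperInvariantMetric.measure_ballOne_pos (hd : IsProperInvariantMetric d) {r : ℝ}
    (hr : 0 < r) : 0 < μ (ballOne d r) := by
  have hU : IsOpen {y | d 1 y < r} :=
    isOpen_lt (hd.continuous.comp (continuous_const.prodMk continuous_id)) continuous_const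
  refine (hU.measure_pos μ ⟨1, ?_⟩).trans_le (measure_mono fun y (hy : d 1 y < r) => hy.le)
  simpa [hd.self_eq_zero] using hr

theorem IsProperInvariantMetric.controlled_diagonal_mul (hd : IsProperInvariantMetric d) {n : ℕ}
    {R : ℝ} (g : G) (x : Fin n → G) :
    (fun j => g * x j) ∈ controlled d n R ↔ x ∈ controlled d n R := by
  simp [controlled, hd.left_invariant]

/-- The tuples of diameter at most `R` whose first entry has distance at most `1` from the
identity. The translates of this relatively compact set cover the tuples of diameter at most `R`,
each of them equally often. -/
def controlledNearOne (d : G → G → ℝ) (n : ℕ) (R : ℝ) : Set (Fin (n + 1) → G) :=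
  {x | x 0 ∈ ballOne d 1} ∩ controlled d (n + 1) R

theorem controlledNearOne_subset (hd : IsProperInvariantMetric d) (n : ℕ) (R : ℝ) :
    controlledNearOne d n R ⊆ Set.univ.pi fun _ => ballOne d (1 + R) := by
  intro x hx j _
  have h₁ := hx.1
  have h₂ := hx.2 0 j
  have := hd.triangle 1 (x 0) (x j)
  change d 1 (x 0) ≤ 1 at h₁
  change d 1 (x j) ≤ 1 + R
  linarith

theorem isCompact_pi_ballOne (hd : IsProperInvariantMetric d) (r : ℝ) :
    IsCompact (Set.univ.pi fun _ : ι => ballOne d r) :=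
  isCompact_univ_pi fun _ => hd.proper 1 r

theorem measurableSet_controlledNearOne (hd : IsProperInvariantMetric d) (n : ℕ) (R : ℝ) :
    MeasurableSet (controlledNearOne d n R) :=
  ((measurable_pi_apply 0) (hd.measurableSet_ballOne 1)).inter (measurableSet_controlled hd _ _)

variable [μ.IsMulRightInvariant]

/-- For unimodular `G`, the elements that move a controlled tuple into `controlledNearOne d n R` form
a set of measure `μ (ballOne d 1)`, whatever the tuple is. -/
theorem setLIntegral_controlledNearOne (hd : IsProperInvariantMetric d) {n : ℕ} (R : ℝ)
    {φ : (Fin (n + 1) → G) → ℝ≥0∞} (hφ : Measurable φ) :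
    ∫⁻ x in controlledNearOne d n R, ∫⁻ g, φ (fun j => g⁻¹ * x j) ∂μ ∂(Measure.pi fun _ => μ) =
      (∫⁻ w in controlled d (n + 1) R, φ w ∂(Measure.pi fun _ => μ)) * μ (ballOne d 1) := by
  rw [setLIntegral_lintegral_inv_diagonal_mul hφ (measurableSet_controlledNearOne hd n R),
    ← lintegral_mul_const _ hφ, ← lintegral_indicator (measurableSet_controlled hd _ _)]
  refine lintegral_congr fun w => ?_
  by_cases hw : w ∈ controlled d (n + 1) R
  · rw [Set.indicator_of_mem hw, ← measure_preimage_mul_right μ (w 0) (ballOne d 1)]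
    congr 2
    ext g
    simp [controlledNearOne, hd.controlled_diagonal_mul, hw]
  · rw [Set.indicator_of_notMem hw]
    have : {g : G | (fun j => g * w j) ∈ controlledNearOne d n R} = ∅ := by
      ext g
      simp [controlledNearOne, hd.controlled_diagonal_mul, hw]
    rw [this, measure_empty, mul_zero]

/-- Only controlled tuples have translates in a bounded cube. -/
theorem lintegral_setLIntegral_pi_le (hd : IsProperInvariantMetric d) {n : ℕ} {R : ℝ} {M : Set G}
    (hM : MeasurableSet M) (hMR : ∀ a ∈ M, ∀ b ∈ M, d a b ≤ R)
    {φ : (Fin (n + 1) → G) → ℝ≥0∞} (hφ : Measurable φ) :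
    ∫⁻ g, ∫⁻ x in Set.univ.pi fun _ => M, φ (fun j => g⁻¹ * x j) ∂(Measure.pi fun _ => μ) ∂μ ≤
      (∫⁻ w in controlled d (n + 1) R, φ w ∂(Measure.pi fun _ => μ)) * μ M := by
  rw [lintegral_setLIntegral_inv_diagonal_mul hφ (MeasurableSet.univ_pi fun _ => hM),
    ← lintegral_mul_const _ hφ, ← lintegral_indicator (measurableSet_controlled hd _ _)]
  refine lintegral_mono fun w => ?_
  by_cases hw : w ∈ controlled d (n + 1) R
  · rw [Set.indicator_of_mem hw, ← measure_preimage_mul_right μ (w 0) M]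
    gcongr
    exact fun g hg => hg 0 (Set.mem_univ _)
  · have : {g : G | (fun j => g * w j) ∈ Set.univ.pi fun _ => M} = ∅ := by
      refine Set.eq_empty_of_forall_notMem fun g hg => hw fun i j => ?_
      rw [← hd.left_invariant g]
      exact hMR _ (hg i (Set.mem_univ _)) _ (hg j (Set.mem_univ _))
    rw [this, measure_empty, mul_zero]
    exact zero_le

end Orbits

/-! ### From continuous to coarse cochains -/

section ToCoarse

variable {G : Type*} [Group G] [TopologicalSpace G] [IsTopologicalGroup G]
  [LocallyCompactSpace G] [SecondCountableTopology G] [MeasurableSpace G] [BorelSpace G]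
  {μ : Measure G} [μ.IsHaarMeasure] {d : G → G → ℝ} {n : ℕ}

theorem leftRegular_apply_ae (g : G) (ξ : Lp ℂ 2 μ) :
    leftRegular μ g ξ =ᵐ[μ] fun h => ξ (g⁻¹ * h) :=
  Lp.coeFn_compMeasurePreserving ξ (measurePreserving_mul_left μ g⁻¹)

/-- The relation `Corresponds` for a function instead of a class of functions. -/
theorem corresponds_iff {f : C(Fin (n + 1) → G, Lp ℂ 2 μ)}
    {β : (Fin (n + 1) → G) →ₘ[Measure.pi fun _ => μ] ℂ} {b : (Fin (n + 1) → G) → ℂ}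
    (hb : β =ᵐ[Measure.pi fun _ => μ] b) :
    Corresponds f β ↔ ∀ᵐ x ∂(Measure.pi fun _ : Fin (n + 1) => μ), ∀ᵐ g ∂μ,
      f x g = b fun j => g⁻¹ * x j := by
  have h := ae_ae_inv_diagonal_mul hb
  constructor <;> intro hf <;> filter_upwards [h, hf] with x hx hfx <;>
    filter_upwards [hx, hfx] with g hg hfg
  · rw [hfg, hg]
  · rw [hfg, hg]

theorem Corresponds.unique {f : C(Fin (n + 1) → G, Lp ℂ 2 μ)}
    {β β' : (Fin (n + 1) → G) →ₘ[Measure.pi fun _ => μ] ℂ} (h : Corresponds f β)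
    (h' : Corresponds f β') : β = β' := by
  refine AEEqFun.ext (ae_of_ae_ae_inv_diagonal_mul
    (measurableSet_eq_fun β.stronglyMeasurable.measurable β'.stronglyMeasurable.measurable) ?_)
  filter_upwards [h, h'] with x hx hx'
  filter_upwards [hx, hx'] with g hg hg'
  rw [← hg, ← hg']

theorem Corresponds.add {f f' : C(Fin (n + 1) → G, Lp ℂ 2 μ)}
    {β β' : (Fin (n + 1) → G) →ₘ[Measure.pi fun _ => μ] ℂ} (h : Corresponds f β)
    (h' : Corresponds f' β') : Corresponds (f + f') (β + β') := by
  rw [corresponds_iff (AEEqFun.coeFn_add β β')]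
  filter_upwards [h, h'] with x hx hx'
  filter_upwards [hx, hx', Lp.coeFn_add (f x) (f' x)] with g hg hg' hadd
  rw [ContinuousMap.add_apply, hadd, Pi.add_apply, hg, hg', Pi.add_apply]

theorem Corresponds.smul (c : ℂ) {f : C(Fin (n + 1) → G, Lp ℂ 2 μ)}
    {β : (Fin (n + 1) → G) →ₘ[Measure.pi fun _ => μ] ℂ} (h : Corresponds f β) :
    Corresponds (c • f) (c • β) := by
  rw [corresponds_iff (AEEqFun.coeFn_smul c β)]
  filter_upwards [h] with x hx
  filter_upwards [hx, Lp.coeFn_smul c (f x)] with g hg hsmul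
  rw [ContinuousMap.smul_apply, hsmul, Pi.smul_apply, hg, Pi.smul_apply]

theorem coeFn_sum_smul_ae {Y E ι : Type*} [MeasurableSpace Y] {ν : Measure Y}
    [NormedAddCommGroup E] [NormedSpace ℂ E] (s : Finset ι) (c : ι → ℂ) (α : ι → Y →ₘ[ν] E) :
    ((∑ i ∈ s, c i • α i : Y →ₘ[ν] E) : Y → E) =ᵐ[ν] fun y => ∑ i ∈ s, c i • α i y := by
  classical
  induction s using Finset.induction_on with
  | empty =>
    filter_upwards [AEEqFun.coeFn_zero (μ := ν) (β := E)] with y hy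
    simpa using hy
  | insert i s hi ih =>
    rw [Finset.sum_insert hi]
    filter_upwards [AEEqFun.coeFn_add (c i • α i) (∑ i ∈ s, c i • α i),
      AEEqFun.coeFn_smul (c i) (α i), ih] with y h₁ h₂ h₃
    rw [h₁, Pi.add_apply, h₂, h₃, Finset.sum_insert hi, Pi.smul_apply]

theorem coeFn_sum_smul_Lp_ae {Y E ι : Type*} [MeasurableSpace Y] {ν : Measure Y}
    [NormedAddCommGroup E] [NormedSpace ℂ E] {p : ℝ≥0∞} (s : Finset ι) (c : ι → ℂ)
    (α : ι → Lp E p ν) :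
    ((∑ i ∈ s, c i • α i : Lp E p ν) : Y → E) =ᵐ[ν] fun y => ∑ i ∈ s, c i • α i y := by
  have h : ((∑ i ∈ s, c i • α i : Lp E p ν) : Y →ₘ[ν] E) =
      ∑ i ∈ s, c i • (α i : Y →ₘ[ν] E) := by
    rw [AddSubgroup.val_finsetSum]
    rfl
  rw [h]
  exact coeFn_sum_smul_ae s c _

/-- The class of functions that underlies a coarse cochain, as a linear map. -/
def coarseVal (d : G → G → ℝ) (μ : Measure G) (n : ℕ) :
    CoarseCochains d μ n →ₗ[ℂ] (Fin (n + 1) → G) →ₘ[Measure.pi fun _ => μ] ℂ :=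
  (coarseSubmodule d μ n).subtype

theorem coeFn_coarseDifferential (hd : IsProperInvariantMetric d) (α : CoarseCochains d μ n) :
    (coarseDifferential μ hd n α).1 =ᵐ[Measure.pi fun _ => μ] altSum α.1 := by
  have h : (coarseDifferential μ hd n α).1 = ∑ i : Fin (n + 2), (-1 : ℂ) ^ (i : ℕ) •
      (coarseFace μ hd i α).1 := by
    change coarseVal d μ (n + 1) (coarseDifferential μ hd n α) =
      ∑ i : Fin (n + 2), (-1 : ℂ) ^ (i : ℕ) • coarseVal d μ (n + 1) (coarseFace μ hd i α)
    simp [coarseDifferential]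
  rw [h]
  have h' : ∀ᵐ x ∂(Measure.pi fun _ : Fin (n + 2) => μ), ∀ i : Fin (n + 2),
      (coarseFace μ hd i α).1 x = α.1 (face i x) :=
    ae_all_iff.2 fun i => AEEqFun.coeFn_compQuasiMeasurePreserving α.1
      (quasiMeasurePreserving_face μ i)
  filter_upwards [coeFn_sum_smul_ae Finset.univ (fun i : Fin (n + 2) => (-1 : ℂ) ^ (i : ℕ))
    (fun i => (coarseFace μ hd i α).1), h'] with x h₁ h₂
  rw [h₁]
  simp only [h₂]
  rfl

theorem Corresponds.differential (hd : IsProperInvariantMetric d)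
    {f : continuousCochains (leftRegular μ) n} {β : CoarseCochains d μ n}
    (h : Corresponds f.1 β.1) :
    Corresponds (continuousDifferential (leftRegular μ) n f).1 (coarseDifferential μ hd n β).1 := by
  rw [corresponds_iff (coeFn_coarseDifferential hd β)]
  have h' : ∀ᵐ x ∂(Measure.pi fun _ : Fin (n + 2) => μ), ∀ i : Fin (n + 2), ∀ᵐ g ∂μ,
      f.1 (face i x) g = β.1 fun j => g⁻¹ * face i x j :=
    ae_all_iff.2 fun i => (quasiMeasurePreserving_face μ i).ae h
  filter_upwards [h'] with x hx
  filter_upwards [ae_all_iff.2 hx, coeFn_sum_smul_Lp_ae Finset.univ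
    (fun i : Fin (n + 2) => (-1 : ℂ) ^ (i : ℕ)) (fun i => f.1 (face i x))] with g hg hsum
  refine hsum.trans ?_
  simp only [hg]
  rfl

/-- On `G_R^{n+1}`, the `L²`-norm of a coarse cochain is, up to a constant factor, the `L²`-norm over
a relatively compact set of a continuous cochain that corresponds to it. -/
theorem Corresponds.setLIntegral_eq [μ.IsMulRightInvariant] (hd : IsProperInvariantMetric d)
    {f : C(Fin (n + 1) → G, Lp ℂ 2 μ)} {b : (Fin (n + 1) → G) → ℂ} (hb : Measurable b)
    (h : ∀ᵐ x ∂(Measure.pi fun _ : Fin (n + 1) => μ), ∀ᵐ g ∂μ, f x g = b fun j => g⁻¹ * x j)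
    (R : ℝ) :
    (∫⁻ w in controlled d (n + 1) R, ‖b w‖ₑ ^ 2 ∂(Measure.pi fun _ => μ)) * μ (ballOne d 1) =
      ∫⁻ x in controlledNearOne d n R, ‖f x‖ₑ ^ 2 ∂(Measure.pi fun _ => μ) := by
  rw [← setLIntegral_controlledNearOne hd R (hb.enorm.pow_const 2)]
  refine lintegral_congr_ae (ae_restrict_of_ae ?_)
  filter_upwards [h] with x hx
  rw [Lp.enorm_def, eLpNorm_two_sq]
  exact lintegral_congr_ae (hx.mono fun g hg => by simp only [hg])

theorem Corresponds.setLIntegral_le [μ.IsMulRightInvariant] (hd : IsProperInvariantMetric d)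
    {f : C(Fin (n + 1) → G, Lp ℂ 2 μ)} {b : (Fin (n + 1) → G) → ℂ} (hb : Measurable b)
    (h : ∀ᵐ x ∂(Measure.pi fun _ : Fin (n + 1) => μ), ∀ᵐ g ∂μ, f x g = b fun j => g⁻¹ * x j)
    (R : ℝ) {C : ℝ≥0∞} (hC : ∀ x ∈ Set.univ.pi fun _ => ballOne d (1 + R), ‖f x‖ₑ ≤ C) :
    ∫⁻ w in controlled d (n + 1) R, ‖b w‖ₑ ^ 2 ∂(Measure.pi fun _ => μ) ≤
      C ^ 2 * (μ (ballOne d (1 + R)) ^ (n + 1) / μ (ballOne d 1)) := by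
  rw [← mul_div_assoc, ENNReal.le_div_iff_mul_le (.inl (hd.measure_ballOne_pos one_pos).ne')
    (.inl (hd.measure_ballOne_lt_top 1).ne), Corresponds.setLIntegral_eq hd hb h R]
  refine (lintegral_mono_set (controlledNearOne_subset hd n R)).trans ?_
  refine (setLIntegral_mono measurable_const fun x hx => pow_le_pow_left' (hC x hx) 2).trans
    (le_of_eq ?_)
  rw [setLIntegral_const, Measure.pi_pi]
  simp

/-- Each invariant continuous cochain is given by a measurable function. -/
theorem exists_measurable_corresponds [μ.IsMulRightInvariant]
    (f : continuousCochains (leftRegular μ) n) :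
    ∃ b : (Fin (n + 1) → G) → ℂ, Measurable b ∧
      ∀ᵐ x ∂(Measure.pi fun _ : Fin (n + 1) => μ), ∀ᵐ g ∂μ, f.1 x g = b fun j => g⁻¹ * x j := by
  obtain ⟨F, hF, hFf⟩ := exists_measurable_uncurry (μ := μ) f.1.continuous
  have hinv : ∀ (h : G) (x : Fin (n + 1) → G), ∀ᵐ g ∂μ,
      F (x, g) = F (fun j => h⁻¹ * x j, h⁻¹ * g) := by
    intro h x
    filter_upwards [hFf x, leftRegular_apply_ae h (f.1 fun j => h⁻¹ * x j),
      (measurePreserving_mul_left μ h⁻¹).quasiMeasurePreserving.ae (hFf fun j => h⁻¹ * x j)]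
      with g h₁ h₂ h₃
    rw [h₁, h₃, ← h₂, f.2 h x]
  -- Substituting `h = g * t⁻¹` gives `F (x, g) = F (t * g⁻¹ * x, t)`.
  have hm₁ : Measurable fun p : ((Fin (n + 1) → G) × G) × G =>
      F (fun j => p.2⁻¹ * p.1.1 j, p.2⁻¹ * p.1.2) := hF.comp (by fun_prop)
  have hm₂ : Measurable fun p : ((Fin (n + 1) → G) × G) × G =>
      F (fun j => p.2 * (p.1.2⁻¹ * p.1.1 j), p.2) := hF.comp (by fun_prop)
  have hm₀ : Measurable fun p : ((Fin (n + 1) → G) × G) × G => F p.1 := hF.comp measurable_fst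
  have h₁ : ∀ᵐ p ∂((Measure.pi fun _ : Fin (n + 1) => μ).prod μ), ∀ᵐ h ∂μ,
      F p = F (fun j => h⁻¹ * p.1 j, h⁻¹ * p.2) := by
    rw [Measure.ae_ae_comm (p := fun (p : (Fin (n + 1) → G) × G) h =>
      F p = F (fun j => h⁻¹ * p.1 j, h⁻¹ * p.2)) (measurableSet_eq_fun hm₀ hm₁)]
    refine Filter.Eventually.of_forall fun h => ?_
    have hm : Measurable fun p : (Fin (n + 1) → G) × G => F (fun j => h⁻¹ * p.1 j, h⁻¹ * p.2) :=
      hF.comp (by fun_prop)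
    rw [Measure.ae_prod_iff_ae_ae (measurableSet_eq_fun hF hm)]
    exact Filter.Eventually.of_forall fun x => hinv h x
  have h₂ : ∀ᵐ p ∂((Measure.pi fun _ : Fin (n + 1) => μ).prod μ), ∀ᵐ t ∂μ,
      F p = F (fun j => t * (p.2⁻¹ * p.1 j), t) := by
    filter_upwards [h₁] with p hp
    filter_upwards [(quasiMeasurePreserving_div_left_of_right_invariant μ p.2).ae hp] with t ht
    rw [ht]
    simp [mul_assoc, div_eq_mul_inv]
  rw [Measure.ae_ae_comm (p := fun (p : (Fin (n + 1) → G) × G) t =>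
      F p = F (fun j => t * (p.2⁻¹ * p.1 j), t)) (measurableSet_eq_fun hm₀ hm₂)] at h₂
  obtain ⟨t, ht⟩ := h₂.exists
  refine ⟨fun w => F (fun j => t * w j, t), hF.comp (by fun_prop), ?_⟩
  filter_upwards [Measure.ae_ae_of_ae_prod ht] with x hx
  filter_upwards [hx, hFf x] with g hg hg'
  rw [← hg', hg]

theorem exists_corresponds [μ.IsMulRightInvariant] (hd : IsProperInvariantMetric d)
    (f : continuousCochains (leftRegular μ) n) :
    ∃ β : CoarseCochains d μ n, Corresponds f.1 β.1 := by
  obtain ⟨b, hb, hfb⟩ := exists_measurable_corresponds f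
  have hae := AEEqFun.coeFn_mk b
    (hb.aestronglyMeasurable (μ := Measure.pi fun _ : Fin (n + 1) => μ))
  refine ⟨⟨AEEqFun.mk b hb.aestronglyMeasurable, fun R _ => ?_⟩, (corresponds_iff hae).2 hfb⟩
  obtain ⟨C, hC⟩ := (isCompact_pi_ballOne hd (1 + R)).exists_bound_of_continuousOn
    f.1.continuous.continuousOn
  have h := Corresponds.setLIntegral_le hd hb hfb R (C := ENNReal.ofReal C) fun x hx => by
    rw [← ofReal_norm]
    exact ENNReal.ofReal_le_ofReal (hC x hx)
  rw [eLpNorm_congr_ae (ae_restrict_of_ae hae)]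
  rw [← eLpNorm_two_sq] at h
  refine (ENNReal.pow_lt_top_iff.1 (h.trans_lt ?_)).resolve_right two_ne_zero
  refine ENNReal.mul_lt_top (by simp) (ENNReal.div_lt_top ?_ (hd.measure_ballOne_pos one_pos).ne')
  exact ENNReal.pow_ne_top (hd.measure_ballOne_lt_top _).ne

variable [μ.IsMulRightInvariant]

/-- The linear map that sends an invariant continuous cochain to the unique coarse cochain that
corresponds to it. -/
def toCoarse (μ : Measure G) [μ.IsHaarMeasure] [μ.IsMulRightInvariant]
    (hd : IsProperInvariantMetric d) (n : ℕ) :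
    continuousCochains (leftRegular μ) n →ₗ[ℂ] CoarseCochains d μ n where
  toFun f := (exists_corresponds hd f).choose
  map_add' f f' := Subtype.ext <| (exists_corresponds hd (f + f')).choose_spec.unique <|
    (exists_corresponds hd f).choose_spec.add (exists_corresponds hd f').choose_spec
  map_smul' c f := Subtype.ext <| (exists_corresponds hd (c • f)).choose_spec.unique <|
    (exists_corresponds hd f).choose_spec.smul c

theorem corresponds_toCoarse (hd : IsProperInvariantMetric d)
    (f : continuousCochains (leftRegular μ) n) : Corresponds f.1 (toCoarse μ hd n f).1 :=
  (exists_corresponds hd f).choose_spec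

theorem toCoarse_eq (hd : IsProperInvariantMetric d) {f : continuousCochains (leftRegular μ) n}
    {β : CoarseCochains d μ n} (h : Corresponds f.1 β.1) : toCoarse μ hd n f = β :=
  Subtype.ext ((corresponds_toCoarse hd f).unique h)

theorem toCoarse_differential (hd : IsProperInvariantMetric d)
    (f : continuousCochains (leftRegular μ) n) :
    toCoarse μ hd (n + 1) (continuousDifferential (leftRegular μ) n f) =
      coarseDifferential μ hd n (toCoarse μ hd n f) :=
  toCoarse_eq hd ((corresponds_toCoarse hd f).differential hd)

theorem coarseSeminorm_sq (d : G → G → ℝ) (μ : Measure G) (n : ℕ) (R : Set.Ioi (0 : ℝ))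
    (α : CoarseCochains d μ n) :
    ENNReal.ofReal (coarseSeminorm d μ n R α) ^ 2 =
      ∫⁻ x in controlled d (n + 1) R, ‖α.1 x‖ₑ ^ 2 ∂(Measure.pi fun _ => μ) := by
  rw [← eLpNorm_two_sq]
  congr 1
  exact ENNReal.ofReal_toReal (α.2 R R.2).ne

theorem continuous_toCoarse (hd : IsProperInvariantMetric d) (n : ℕ) :
    Continuous (toCoarse μ hd n) := by
  refine WithSeminorms.continuous_of_continuous_comp (withSeminorms_coarseSeminorm d μ n) _
    fun R => ?_
  -- a bound for the seminorm of the image in terms of a supremum over a compact set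
  set L : Set (Fin (n + 1) → G) := Set.univ.pi fun _ => ballOne d (1 + R)
  set c := μ (ballOne d (1 + R)) ^ (n + 1) / μ (ballOne d 1)
  have hc : c ≠ ∞ := (ENNReal.div_lt_top (ENNReal.pow_ne_top (hd.measure_ballOne_lt_top _).ne)
    (hd.measure_ballOne_pos one_pos).ne').ne
  have hbound : ∀ (f : continuousCochains (leftRegular μ) n) (ε : ℝ), 0 ≤ ε →
      (∀ x ∈ L, ‖f.1 x‖ ≤ ε) →
      coarseSeminorm d μ n R (toCoarse μ hd n f) ≤ ε * √c.toReal := by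
    intro f ε hε h
    have h₁ : _ ≤ ENNReal.ofReal ε ^ 2 * c := Corresponds.setLIntegral_le hd
      (toCoarse μ hd n f).1.stronglyMeasurable.measurable (corresponds_toCoarse hd f) R
      (C := ENNReal.ofReal ε) fun x hx => by
        rw [← ofReal_norm]
        exact ENNReal.ofReal_le_ofReal (h x hx)
    rw [← coarseSeminorm_sq, ← ENNReal.ofReal_toReal hc,
      ← ENNReal.ofReal_pow (apply_nonneg _ _), ← ENNReal.ofReal_pow hε,
      ← ENNReal.ofReal_mul (by positivity)] at h₁
    have h₂ := (ENNReal.ofReal_le_ofReal_iff (by positivity)).1 h₁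
    refine le_of_sq_le_sq ?_ (by positivity)
    rwa [mul_pow, Real.sq_sqrt ENNReal.toReal_nonneg]
  refine Seminorm.continuous (r := 1) ?_
  set ε : ℝ := 1 / (2 * (√c.toReal + 1))
  have hε : 0 < ε := by positivity
  have hopen : IsOpen {f : C(Fin (n + 1) → G, Lp ℂ 2 μ) |
      Set.MapsTo f L (Metric.ball 0 ε)} :=
    ContinuousMap.isOpen_setOfPred_mapsTo (isCompact_pi_ballOne hd _) Metric.isOpen_ball
  refine Filter.mem_of_superset ((hopen.preimage continuous_subtype_val).mem_nhds
    (x := (0 : continuousCochains (leftRegular μ) n)) fun x _ => ?_) fun f hf => ?_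
  · simpa using hε
  · rw [Seminorm.mem_ball_zero]
    refine (hbound f ε hε.le fun x hx => ?_).trans_lt ?_
    · simpa using (mem_ball_zero_iff.1 (hf hx)).le
    · rw [one_div_mul_eq_div, div_lt_one (by positivity)]
      have := Real.sqrt_nonneg c.toReal
      linarith

end ToCoarse

/-! ### Smoothing -/

section Smoothing

variable {G : Type*} [Group G] [TopologicalSpace G] [IsTopologicalGroup G]
  [LocallyCompactSpace G] [SecondCountableTopology G] [MeasurableSpace G] [BorelSpace G]
  {μ : Measure G} [μ.IsHaarMeasure] {d : G → G → ℝ} {χ : G → ℝ}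

/-- A continuous function with compact support and integral `1`. -/
structure IsNormalizedWeight (μ : Measure G) (χ : G → ℝ) : Prop where
  continuous : Continuous χ
  hasCompactSupport : HasCompactSupport χ
  integral_eq_one : ∫ g, χ g ∂μ = 1

theorem exists_isNormalizedWeight (μ : Measure G) [μ.IsHaarMeasure] :
    ∃ χ : G → ℝ, IsNormalizedWeight μ χ := by
  obtain ⟨f, hf, hf0, hf1⟩ := exists_continuous_nonneg_pos (1 : G)
  have hpos := f.continuous.integral_pos_of_hasCompactSupport_nonneg_nonzero (μ := μ) hf hf0 hf1
  refine ⟨fun g => (∫ x, f x ∂μ)⁻¹ * f g, continuous_const.mul f.continuous, hf.mul_left, ?_⟩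
  rw [integral_const_mul, inv_mul_cancel₀ hpos.ne']

/-- The product weight `∏ i, χ (y i)` on `G^ι`. -/
def prodWeight {ι : Type*} [Fintype ι] (χ : G → ℝ) (y : ι → G) : ℝ := ∏ i, χ (y i)

section ProdWeight

variable {ι : Type*} [Fintype ι]

theorem IsNormalizedWeight.continuous_prodWeight (hχ : IsNormalizedWeight μ χ) :
    Continuous fun y : ι → G => prodWeight χ y :=
  continuous_finsetProd _ fun i _ => hχ.continuous.comp (continuous_apply i)

theorem prodWeight_eq_zero {y : ι → G} (hy : y ∉ Set.univ.pi fun _ => tsupport χ) :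
    prodWeight χ y = 0 := by
  simp only [Set.mem_pi, not_forall] at hy
  obtain ⟨i, -, hi⟩ := hy
  exact Finset.prod_eq_zero (Finset.mem_univ i) (image_eq_zero_of_notMem_tsupport hi)

theorem IsNormalizedWeight.isCompact_pi_tsupport (hχ : IsNormalizedWeight μ χ) :
    IsCompact (Set.univ.pi fun _ : ι => tsupport χ) :=
  isCompact_univ_pi fun _ => hχ.hasCompactSupport

theorem IsNormalizedWeight.hasCompactSupport_prodWeight [T2Space G]
    (hχ : IsNormalizedWeight μ χ) : HasCompactSupport fun y : ι → G => prodWeight χ y :=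
  HasCompactSupport.intro hχ.isCompact_pi_tsupport fun _ hy => prodWeight_eq_zero hy

theorem IsNormalizedWeight.integral_prodWeight (hχ : IsNormalizedWeight μ χ) :
    ∫ y : ι → G, prodWeight χ y ∂(Measure.pi fun _ => μ) = 1 := by
  simp only [prodWeight]
  rw [integral_fintype_prod_eq_prod]
  simp [hχ.integral_eq_one]

theorem IsNormalizedWeight.continuous_translate (hχ : IsNormalizedWeight μ χ) :
    Continuous fun p : (ι → G) × (ι → G) => prodWeight χ (p.1⁻¹ * p.2) :=
  hχ.continuous_prodWeight.comp (by fun_prop)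

open scoped Pointwise in
/-- The translates of the product weight by elements of a compact set have their supports in a
common compact cube. -/
theorem IsNormalizedWeight.exists_isCompact_translate (hχ : IsNormalizedWeight μ χ)
    {L : Set (ι → G)} (hL : IsCompact L) :
    ∃ M : Set G, IsCompact M ∧
      ∀ x ∈ L, ∀ u ∉ Set.univ.pi fun _ : ι => M, prodWeight χ (x⁻¹ * u) = 0 := by
  refine ⟨(⋃ i, (fun x : ι → G => x i) '' L) * tsupport χ,
    (isCompact_iUnion fun i => hL.image (continuous_apply i)).mul hχ.hasCompactSupport,
    fun x hx u hu => prodWeight_eq_zero fun h => hu fun i _ => ?_⟩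
  exact Set.mem_mul.2 ⟨x i, Set.mem_iUnion.2 ⟨i, x, hx, rfl⟩, x⁻¹ i * u i, h i (Set.mem_univ _),
    by simp⟩

end ProdWeight

section Face

variable {E : Type*} [NormedAddCommGroup E] [NormedSpace ℝ E] {n : ℕ}

theorem prodWeight_succAbove (i : Fin (n + 1)) (y : Fin (n + 1) → G) :
    prodWeight χ y = χ (y i) * prodWeight χ fun j => y (i.succAbove j) :=
  Fin.prod_univ_succAbove _ i

/-- An entry on which the integrand does not depend can be integrated out. -/
theorem IsNormalizedWeight.integral_face (hχ : IsNormalizedWeight μ χ) (i : Fin (n + 1))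
    (c : (Fin n → G) → E) :
    ∫ y, prodWeight χ y • c (fun j => y (i.succAbove j)) ∂(Measure.pi fun _ => μ) =
      ∫ y, prodWeight χ y • c y ∂(Measure.pi fun _ => μ) := by
  have hmp := measurePreserving_piFinSuccAbove (fun _ : Fin (n + 1) => μ) i
  have h := hmp.integral_comp (MeasurableEquiv.measurableEmbedding _)
    fun p : G × (Fin n → G) => χ p.1 • (prodWeight χ p.2 • c p.2)
  have h' := integral_prod_smul (μ := μ) (ν := Measure.pi fun _ : Fin n => μ) χ
    fun y => prodWeight χ y • c y
  rw [h', hχ.integral_eq_one, one_smul] at h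
  rw [← h]
  refine integral_congr_ae (Filter.Eventually.of_forall fun y => ?_)
  simp only [prodWeight_succAbove i, smul_smul]
  rfl

theorem IsNormalizedWeight.integrable_face [T2Space G] (hχ : IsNormalizedWeight μ χ)
    (i : Fin (n + 1)) {c : (Fin n → G) → E}
    (hc : Integrable (fun y => prodWeight χ y • c y) (Measure.pi fun _ => μ)) :
    Integrable (fun y => prodWeight χ y • c fun j => y (i.succAbove j))
      (Measure.pi fun _ => μ) := by
  have hmp := measurePreserving_piFinSuccAbove (fun _ : Fin (n + 1) => μ) i
  have hχi : Integrable χ μ := hχ.continuous.integrable_of_hasCompactSupport hχ.hasCompactSupport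
  have h := (hmp.integrable_comp_emb (MeasurableEquiv.measurableEmbedding _)).2
    (hχi.smul_prod hc)
  refine h.congr (Filter.Eventually.of_forall fun y => ?_)
  simp only [Function.comp, prodWeight_succAbove i, smul_smul]
  rfl

end Face

/-- The smoothing `∫ (∏ i, χ (yᵢ)) b (x₀ y₀, …, xₙ yₙ) dy` of a function `b`. -/
def smoothing {ι E : Type*} [Fintype ι] [NormedAddCommGroup E] [NormedSpace ℝ E] (μ : Measure G)
    (χ : G → ℝ) (b : (ι → G) → E) (x : ι → G) : E :=
  ∫ y, prodWeight χ y • b (x * y) ∂(Measure.pi fun _ => μ)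

section

variable {ι E : Type*} [Fintype ι] [NormedAddCommGroup E] [NormedSpace ℝ E]

theorem smoothing_eq (b : (ι → G) → E) (x : ι → G) :
    smoothing μ χ b x = ∫ u, prodWeight χ (x⁻¹ * u) • b u ∂(Measure.pi fun _ => μ) := by
  rw [smoothing, ← integral_mul_left_eq_self
    (μ := Measure.pi fun _ : ι => μ) (fun u => prodWeight χ (x⁻¹ * u) • b u) x]
  simp

theorem smoothing_inv_diagonal_mul (b : (ι → G) → E) (x : ι → G) (g : G) :
    smoothing μ χ b (fun j => g⁻¹ * x j) =
      ∫ u, prodWeight χ (x⁻¹ * u) • b (fun j => g⁻¹ * u j) ∂(Measure.pi fun _ => μ) := by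
  rw [smoothing, ← integral_mul_left_eq_self (μ := Measure.pi fun _ : ι => μ)
    (fun u => prodWeight χ (x⁻¹ * u) • b (fun j => g⁻¹ * u j)) x]
  simp [Pi.mul_def, mul_assoc]

theorem smoothing_congr_ae {b b' : (ι → G) → E} (h : b =ᵐ[Measure.pi fun _ => μ] b') :
    smoothing μ χ b = smoothing μ χ b' := by
  funext x
  rw [smoothing_eq, smoothing_eq]
  exact integral_congr_ae (h.mono fun u hu => by simp only [hu])

theorem IsNormalizedWeight.integrable_translate_smul [T2Space G] (hχ : IsNormalizedWeight μ χ)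
    {b : (ι → G) → E} (hb : LocallyIntegrable b (Measure.pi fun _ => μ)) (x : ι → G) :
    Integrable (fun u => prodWeight χ (x⁻¹ * u) • b u) (Measure.pi fun _ => μ) := by
  refine hb.integrable_smul_left_of_hasCompactSupport
    (hχ.continuous_translate.comp (.prodMk_right x)) ?_
  exact hχ.hasCompactSupport_prodWeight.comp_homeomorph (Homeomorph.mulLeft x⁻¹)

theorem IsNormalizedWeight.integrable_smoothing [T2Space G] (hχ : IsNormalizedWeight μ χ)
    {b : (ι → G) → E} (hb : LocallyIntegrable b (Measure.pi fun _ => μ)) (x : ι → G) :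
    Integrable (fun y => prodWeight χ y • b (x * y)) (Measure.pi fun _ => μ) := by
  have h := (hχ.integrable_translate_smul hb x).comp_mul_left x
  simpa using h

end

theorem IsNormalizedWeight.smoothing_altSum [T2Space G] {E : Type*} [NormedAddCommGroup E]
    [NormedSpace ℂ E] {n : ℕ} (hχ : IsNormalizedWeight μ χ) {b : (Fin n → G) → E}
    (hb : LocallyIntegrable b (Measure.pi fun _ => μ)) (x : Fin (n + 1) → G) :
    smoothing μ χ (altSum b) x = altSum (smoothing μ χ b) x := by
  have hint : ∀ i : Fin (n + 1), Integrable (fun y => prodWeight χ y •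
      b fun j => x (i.succAbove j) * y (i.succAbove j)) (Measure.pi fun _ => μ) := fun i =>
    hχ.integrable_face i (hχ.integrable_smoothing hb fun j => x (i.succAbove j))
  simp only [smoothing, altSum, Finset.smul_sum, smul_comm (_ : ℝ) (_ : ℂ)]
  refine (integral_finsetSum _ fun i _ => (hint i).smul ((-1 : ℂ) ^ (i : ℕ))).trans ?_
  refine Finset.sum_congr rfl fun i _ => ?_
  refine (integral_smul _ _).trans ?_
  congr 1
  exact hχ.integral_face i fun y => b ((fun j => x (i.succAbove j)) * y)

end Smoothing

/-! ### From coarse to continuous cochains -/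

section FromCoarse

variable {G : Type*} [Group G] [TopologicalSpace G] [IsTopologicalGroup G] [T2Space G]
  [LocallyCompactSpace G] [SecondCountableTopology G] [MeasurableSpace G] [BorelSpace G]
  {μ : Measure G} [μ.IsHaarMeasure] {d : G → G → ℝ} {χ : G → ℝ} {n : ℕ}

theorem IsProperInvariantMetric.exists_bound (hd : IsProperInvariantMetric d) {M : Set G}
    (hM : IsCompact M) : ∃ R : ℝ, 0 < R ∧ ∀ a ∈ M, ∀ b ∈ M, d a b ≤ R := by
  obtain ⟨C, hC⟩ := (hM.prod hM).exists_bound_of_continuousOn hd.continuous.continuousOn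
  refine ⟨max C 1, by positivity, fun a ha b hb => ?_⟩
  exact (le_abs_self _).trans ((hC (a, b) ⟨ha, hb⟩).trans (le_max_left _ _))

theorem locallyIntegrable_coarse (hd : IsProperInvariantMetric d) (β : CoarseCochains d μ n) :
    LocallyIntegrable β.1 (Measure.pi fun _ => μ) := by
  rw [locallyIntegrable_iff]
  intro L hL
  have hM : IsCompact (⋃ i, (fun x : Fin (n + 1) → G => x i) '' L) :=
    isCompact_iUnion fun i => hL.image (continuous_apply i)
  obtain ⟨R, hR, hMR⟩ := hd.exists_bound hM
  have hsub : L ⊆ controlled d (n + 1) R := fun x hx i j =>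
    hMR _ (Set.mem_iUnion.2 ⟨i, x, hx, rfl⟩) _ (Set.mem_iUnion.2 ⟨j, x, hx, rfl⟩)
  have : IsFiniteMeasure ((Measure.pi fun _ : Fin (n + 1) => μ).restrict L) :=
    ⟨by simpa using hL.measure_lt_top⟩
  exact ((memLp_coarse β hR).mono_measure (Measure.restrict_mono hsub le_rfl)).integrable
    (by norm_num)

variable [μ.IsMulRightInvariant]

/-- The basic estimate for integrals `∫ k(u) b(g⁻¹ u) du` as functions of `g`. -/
theorem lintegral_sq_enorm_integral_le (hd : IsProperInvariantMetric d) {R : ℝ} {M : Set G}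
    (hM : MeasurableSet M) (hMR : ∀ a ∈ M, ∀ b ∈ M, d a b ≤ R) {k : (Fin (n + 1) → G) → ℝ}
    (hk : Measurable k) (hkM : ∀ u ∉ Set.univ.pi fun _ => M, k u = 0)
    {b : (Fin (n + 1) → G) → ℂ} (hb : Measurable b) :
    ∫⁻ g, ‖∫ u, k u • b (fun j => g⁻¹ * u j) ∂(Measure.pi fun _ => μ)‖ₑ ^ 2 ∂μ ≤
      (∫⁻ u in Set.univ.pi fun _ => M, ‖k u‖ₑ ^ 2 ∂(Measure.pi fun _ => μ)) *
        ((∫⁻ w in controlled d (n + 1) R, ‖b w‖ₑ ^ 2 ∂(Measure.pi fun _ => μ)) * μ M) := by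
  have hmeas : Measurable fun g => ∫⁻ x in Set.univ.pi fun _ : Fin (n + 1) => M,
      ‖b fun j => g⁻¹ * x j‖ₑ ^ 2 ∂(Measure.pi fun _ => μ) := by
    have : Measurable fun p : G × (Fin (n + 1) → G) => ‖b fun j => p.1⁻¹ * p.2 j‖ₑ ^ 2 :=
      (hb.comp (by fun_prop)).enorm.pow_const 2
    exact this.lintegral_prod_right'
  refine le_trans ?_ (mul_le_mul_right
    (lintegral_setLIntegral_pi_le (μ := μ) hd hM hMR (hb.enorm.pow_const 2)) _)
  rw [← lintegral_const_mul _ hmeas]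
  refine lintegral_mono fun g => ?_
  exact sq_enorm_integral_smul_le hk.aemeasurable
    (hb.comp (by fun_prop)).aestronglyMeasurable hkM

theorem measurable_integral_inv_diagonal_mul {k : (Fin (n + 1) → G) → ℝ} (hk : Measurable k)
    {b : (Fin (n + 1) → G) → ℂ} (hb : Measurable b) :
    StronglyMeasurable fun g : G =>
      ∫ u, k u • b (fun j => g⁻¹ * u j) ∂(Measure.pi fun _ : Fin (n + 1) => μ) := by
  have h : Measurable fun p : G × (Fin (n + 1) → G) => k p.2 • b fun j => p.1⁻¹ * p.2 j :=
    (hk.comp measurable_snd).smul (hb.comp (by fun_prop))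
  exact StronglyMeasurable.integral_prod_right h.stronglyMeasurable

/-- The smoothing of a coarse cochain is square-integrable along each orbit of `G`. -/
theorem IsNormalizedWeight.memLp_smoothing (hχ : IsNormalizedWeight μ χ)
    (hd : IsProperInvariantMetric d) (β : CoarseCochains d μ n) (x : Fin (n + 1) → G) :
    MemLp (fun g => smoothing μ χ β.1 fun j => g⁻¹ * x j) 2 μ := by
  obtain ⟨M, hM, hMx⟩ := hχ.exists_isCompact_translate (isCompact_singleton (x := x))
  obtain ⟨R, hR, hMR⟩ := hd.exists_bound hM
  have hk : Continuous fun u => prodWeight χ (x⁻¹ * u) :=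
    hχ.continuous_translate.comp (.prodMk_right x)
  have hb := β.1.stronglyMeasurable.measurable
  simp only [smoothing_inv_diagonal_mul]
  refine ⟨(measurable_integral_inv_diagonal_mul hk.measurable hb).aestronglyMeasurable, ?_⟩
  suffices h : eLpNorm _ 2 μ ^ 2 < ∞ from (ENNReal.pow_lt_top_iff.1 h).resolve_right two_ne_zero
  rw [eLpNorm_two_sq]
  refine (lintegral_sq_enorm_integral_le hd hM.measurableSet hMR hk.measurable (hMx x rfl)
    hb).trans_lt (ENNReal.mul_lt_top ?_ (ENNReal.mul_lt_top ?_ hM.measure_lt_top))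
  · obtain ⟨C, hC⟩ := (isCompact_univ_pi fun _ : Fin (n + 1) => hM).exists_bound_of_continuousOn
      hk.continuousOn
    refine (setLIntegral_mono (g := fun _ => ENNReal.ofReal C ^ 2) measurable_const fun u hu =>
      pow_le_pow_left' ?_ 2).trans_lt ?_
    · rw [← ofReal_norm]
      exact ENNReal.ofReal_le_ofReal (hC u hu)
    · rw [setLIntegral_const]
      exact ENNReal.mul_lt_top (by simp) (isCompact_univ_pi fun _ => hM).measure_lt_top
  · rw [← coarseSeminorm_sq d μ n ⟨R, hR⟩]
    simp

/-- The element `g ↦ (smoothing of β) (g⁻¹ x)` of `L²(G)`. -/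
def IsNormalizedWeight.orbitMap (hχ : IsNormalizedWeight μ χ) (hd : IsProperInvariantMetric d)
    (β : CoarseCochains d μ n) (x : Fin (n + 1) → G) : Lp ℂ 2 μ :=
  (hχ.memLp_smoothing hd β x).toLp _

theorem IsNormalizedWeight.coeFn_orbitMap (hχ : IsNormalizedWeight μ χ)
    (hd : IsProperInvariantMetric d) (β : CoarseCochains d μ n) (x : Fin (n + 1) → G) :
    hχ.orbitMap hd β x =ᵐ[μ] fun g => smoothing μ χ β.1 fun j => g⁻¹ * x j :=
  MemLp.coeFn_toLp _

theorem IsNormalizedWeight.sq_enorm_orbitMap (hχ : IsNormalizedWeight μ χ)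
    (hd : IsProperInvariantMetric d) (β : CoarseCochains d μ n) (x : Fin (n + 1) → G) :
    ‖hχ.orbitMap hd β x‖ₑ ^ 2 = ∫⁻ g, ‖∫ u, prodWeight χ (x⁻¹ * u) • β.1 (fun j => g⁻¹ * u j)
      ∂(Measure.pi fun _ => μ)‖ₑ ^ 2 ∂μ := by
  rw [Lp.enorm_def, eLpNorm_two_sq]
  refine lintegral_congr_ae ((hχ.coeFn_orbitMap hd β x).mono fun g hg => ?_)
  simp only [hg, smoothing_inv_diagonal_mul]

theorem IsNormalizedWeight.sq_enorm_orbitMap_sub (hχ : IsNormalizedWeight μ χ)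
    (hd : IsProperInvariantMetric d) (β : CoarseCochains d μ n) (x x' : Fin (n + 1) → G) :
    ‖hχ.orbitMap hd β x - hχ.orbitMap hd β x'‖ₑ ^ 2 =
      ∫⁻ g, ‖∫ u, (prodWeight χ (x⁻¹ * u) - prodWeight χ (x'⁻¹ * u)) •
        β.1 (fun j => g⁻¹ * u j) ∂(Measure.pi fun _ => μ)‖ₑ ^ 2 ∂μ := by
  rw [Lp.enorm_def, eLpNorm_two_sq]
  refine lintegral_congr_ae ?_
  have hint : ∀ (g : G) (x : Fin (n + 1) → G), Integrable (fun u => prodWeight χ (x⁻¹ * u) •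
      β.1 (fun j => g⁻¹ * u j)) (Measure.pi fun _ => μ) := by
    intro g x
    have h := (hχ.integrable_translate_smul (locallyIntegrable_coarse hd β)
      (fun j => g⁻¹ * x j)).comp_mul_left (fun _ => g⁻¹)
    refine h.congr (Filter.Eventually.of_forall fun u => ?_)
    have : (fun j => g⁻¹ * x j)⁻¹ * ((fun _ => g⁻¹) * u) = x⁻¹ * u := by
      funext j
      simp
    simp only [this]
    rfl
  filter_upwards [hχ.coeFn_orbitMap hd β x, hχ.coeFn_orbitMap hd β x',
    Lp.coeFn_sub (hχ.orbitMap hd β x) (hχ.orbitMap hd β x')] with g h₁ h₂ h₃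
  simp only [h₃, Pi.sub_apply, h₁, h₂, smoothing_inv_diagonal_mul, sub_smul]
  rw [integral_sub (hint g x) (hint g x')]

theorem IsNormalizedWeight.continuous_orbitMap (hχ : IsNormalizedWeight μ χ)
    (hd : IsProperInvariantMetric d) (β : CoarseCochains d μ n) :
    Continuous (hχ.orbitMap hd β) := by
  refine continuous_iff_continuousAt.2 fun x₀ => ?_
  obtain ⟨N, hN, hNx⟩ := exists_compact_mem_nhds x₀
  obtain ⟨M, hM, hMN⟩ := hχ.exists_isCompact_translate hN
  obtain ⟨R, hR, hMR⟩ := hd.exists_bound hM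
  have hM' : IsCompact (Set.univ.pi fun _ : Fin (n + 1) => M) := isCompact_univ_pi fun _ => hM
  let C := (∫⁻ w in controlled d (n + 1) R, ‖β.1 w‖ₑ ^ 2 ∂(Measure.pi fun _ => μ)) * μ M
  have hC : C ≠ ∞ := by
    refine (ENNReal.mul_lt_top ?_ hM.measure_lt_top).ne
    rw [← coarseSeminorm_sq d μ n ⟨R, hR⟩]
    simp
  let k : (Fin (n + 1) → G) → (Fin (n + 1) → G) → ℝ :=
    fun x u => prodWeight χ (x⁻¹ * u) - prodWeight χ (x₀⁻¹ * u)
  have hk : Continuous (Function.uncurry k) :=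
    hχ.continuous_translate.sub (hχ.continuous_translate.comp
      (continuous_const.prodMk continuous_snd))
  let I : (Fin (n + 1) → G) → ℝ :=
    fun x => ∫ u in Set.univ.pi fun _ => M, k x u ^ 2 ∂(Measure.pi fun _ => μ)
  have hI : Continuous I :=
    continuous_parametric_integral_of_continuous (hk.pow 2) hM'
  have hI₀ : I x₀ = 0 := by simp [I, k]
  have hle : ∀ x ∈ N, ‖hχ.orbitMap hd β x - hχ.orbitMap hd β x₀‖ₑ ^ 2 ≤
      ENNReal.ofReal (I x) * C := by
    intro x hx
    have hkx : Continuous (k x) := hk.comp (.prodMk_right x)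
    rw [hχ.sq_enorm_orbitMap_sub hd]
    refine (lintegral_sq_enorm_integral_le hd hM.measurableSet hMR hkx.measurable
      (fun u hu => ?_) β.1.stronglyMeasurable.measurable).trans (le_of_eq ?_)
    · simp only [k]
      rw [hMN x hx u hu, hMN x₀ (mem_of_mem_nhds hNx) u hu, sub_zero]
    · congr 1
      have hint : IntegrableOn (fun u => k x u ^ 2) (Set.univ.pi fun _ => M)
          (Measure.pi fun _ => μ) := (hkx.pow 2).continuousOn.integrableOn_compact hM'
      refine Eq.trans ?_ (ofReal_integral_eq_lintegral_ofReal hint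
        (Filter.Eventually.of_forall fun u => sq_nonneg _)).symm
      refine lintegral_congr fun u => ?_
      rw [← ofReal_norm, ← ENNReal.ofReal_pow (norm_nonneg _), Real.norm_eq_abs, sq_abs]
  have hlim : Filter.Tendsto (fun x => √(I x * C.toReal)) (𝓝 x₀) (𝓝 0) := by
    have h : Continuous fun x => √(I x * C.toReal) :=
      Real.continuous_sqrt.comp (hI.mul continuous_const)
    have := h.tendsto x₀
    rwa [hI₀, zero_mul, Real.sqrt_zero] at this
  rw [ContinuousAt, tendsto_iff_norm_sub_tendsto_zero]
  refine squeeze_zero' (Filter.Eventually.of_forall fun _ => norm_nonneg _) ?_ hlim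
  filter_upwards [hNx] with x hx
  have hIx : 0 ≤ I x := integral_nonneg fun u => sq_nonneg _
  have h := hle x hx
  rw [← ofReal_norm, ← ENNReal.ofReal_pow (norm_nonneg _), ← ENNReal.ofReal_toReal hC,
    ← ENNReal.ofReal_mul hIx] at h
  exact Real.le_sqrt_of_sq_le
    ((ENNReal.ofReal_le_ofReal_iff (mul_nonneg hIx ENNReal.toReal_nonneg)).1 h)

/-- The linear map that smooths a coarse cochain `β` and sends it to the invariant continuous
cochain `x ↦ (g ↦ (smoothing of β) (g⁻¹ x))`. -/
def IsNormalizedWeight.fromCoarse (hχ : IsNormalizedWeight μ χ) (hd : IsProperInvariantMetric d)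
    (n : ℕ) : CoarseCochains d μ n →ₗ[ℂ] continuousCochains (leftRegular μ) n where
  toFun β := ⟨⟨hχ.orbitMap hd β, hχ.continuous_orbitMap hd β⟩, fun g x => by
    refine Lp.ext ?_
    refine (leftRegular_apply_ae g _).trans ?_
    filter_upwards [(measurePreserving_mul_left μ g⁻¹).quasiMeasurePreserving.ae
      (hχ.coeFn_orbitMap hd β fun j => g⁻¹ * x j), hχ.coeFn_orbitMap hd β x] with h h₁ h₂
    refine h₁.trans (Eq.trans ?_ h₂.symm)
    simp [mul_assoc]⟩
  map_add' α β := by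
    refine Subtype.ext (ContinuousMap.ext fun x => Lp.ext ?_)
    refine Filter.EventuallyEq.trans ?_
      (Lp.coeFn_add (hχ.orbitMap hd α x) (hχ.orbitMap hd β x)).symm
    filter_upwards [hχ.coeFn_orbitMap hd (α + β) x, hχ.coeFn_orbitMap hd α x,
      hχ.coeFn_orbitMap hd β x] with g h₁ h₂ h₃
    refine h₁.trans ?_
    rw [Pi.add_apply, h₂, h₃, coarse_coe_add, smoothing_congr_ae (AEEqFun.coeFn_add α.1 β.1)]
    simp only [smoothing, Pi.add_apply, smul_add]
    exact integral_add (hχ.integrable_smoothing (locallyIntegrable_coarse hd α) _)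
      (hχ.integrable_smoothing (locallyIntegrable_coarse hd β) _)
  map_smul' c β := by
    refine Subtype.ext (ContinuousMap.ext fun x => Lp.ext ?_)
    refine Filter.EventuallyEq.trans ?_ (Lp.coeFn_smul c (hχ.orbitMap hd β x)).symm
    filter_upwards [hχ.coeFn_orbitMap hd (c • β) x, hχ.coeFn_orbitMap hd β x] with g h₁ h₂
    refine h₁.trans ?_
    rw [Pi.smul_apply, h₂, coarse_coe_smul, smoothing_congr_ae (AEEqFun.coeFn_smul c β.1)]
    simp only [smoothing, Pi.smul_apply, smul_comm (_ : ℝ) c]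
    exact integral_smul _ _

theorem IsNormalizedWeight.fromCoarse_differential (hχ : IsNormalizedWeight μ χ)
    (hd : IsProperInvariantMetric d) (β : CoarseCochains d μ n) :
    hχ.fromCoarse hd (n + 1) (coarseDifferential μ hd n β) =
      continuousDifferential (leftRegular μ) n (hχ.fromCoarse hd n β) := by
  refine Subtype.ext (ContinuousMap.ext fun x => Lp.ext ?_)
  refine Filter.EventuallyEq.trans ?_ (coeFn_sum_smul_Lp_ae Finset.univ
    (fun i : Fin (n + 2) => (-1 : ℂ) ^ (i : ℕ)) (fun i => hχ.orbitMap hd β (face i x))).symm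
  filter_upwards [hχ.coeFn_orbitMap hd (coarseDifferential μ hd n β) x,
    ae_all_iff.2 fun i : Fin (n + 2) => hχ.coeFn_orbitMap hd β (face i x)] with g h₁ h₂
  refine h₁.trans ?_
  rw [smoothing_congr_ae (coeFn_coarseDifferential hd β),
    hχ.smoothing_altSum (locallyIntegrable_coarse hd β)]
  simp only [h₂]
  rfl

theorem IsNormalizedWeight.continuous_fromCoarse (hχ : IsNormalizedWeight μ χ)
    (hd : IsProperInvariantMetric d) (n : ℕ) : Continuous (hχ.fromCoarse hd n) := by
  refine continuous_induced_rng.2 ?_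
  refine continuous_of_continuousAt_zero
    ((continuousCochains (leftRegular μ) n).subtype.comp (hχ.fromCoarse hd n)) ?_
  rw [ContinuousAt, map_zero, ContinuousMap.tendsto_iff_forall_isCompact_tendstoUniformlyOn]
  intro L hL
  obtain ⟨M, hM, hML⟩ := hχ.exists_isCompact_translate hL
  obtain ⟨R, hR, hMR⟩ := hd.exists_bound hM
  set q := coarseSeminorm d μ n ⟨R, hR⟩
  set K := ∫⁻ y, ‖prodWeight χ y‖ₑ ^ 2 ∂(Measure.pi fun _ : Fin (n + 1) => μ)
  have hK : K ≠ ∞ := by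
    have h := hχ.continuous_prodWeight (ι := Fin (n + 1)).memLp_of_hasCompactSupport
      (μ := Measure.pi fun _ => μ) (p := 2) hχ.hasCompactSupport_prodWeight
    have h' := ENNReal.pow_ne_top h.2.ne (n := 2)
    rwa [eLpNorm_two_sq] at h'
  have hle : ∀ (β : CoarseCochains d μ n), ∀ x ∈ L,
      ‖hχ.orbitMap hd β x‖ ≤ q β * √(K * μ M).toReal := by
    intro β x hx
    have hk : Continuous fun u => prodWeight χ (x⁻¹ * u) :=
      hχ.continuous_translate.comp (.prodMk_right x)
    have h₁ : ‖hχ.orbitMap hd β x‖ₑ ^ 2 ≤ K * (ENNReal.ofReal (q β) ^ 2 * μ M) := by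
      rw [hχ.sq_enorm_orbitMap hd, coarseSeminorm_sq]
      refine (lintegral_sq_enorm_integral_le hd hM.measurableSet hMR hk.measurable (hML x hx)
        β.1.stronglyMeasurable.measurable).trans (mul_le_mul_left ?_ _)
      refine (setLIntegral_le_lintegral _ _).trans (le_of_eq ?_)
      exact lintegral_mul_left_eq_self (μ := Measure.pi fun _ : Fin (n + 1) => μ)
        (fun y => ‖prodWeight χ y‖ₑ ^ 2) x⁻¹
    rw [mul_left_comm, ← ENNReal.ofReal_toReal (ENNReal.mul_ne_top hK hM.measure_lt_top.ne),
      ← ofReal_norm, ← ENNReal.ofReal_pow (norm_nonneg _), ← ENNReal.ofReal_pow (apply_nonneg _ _),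
      ← ENNReal.ofReal_mul (by positivity)] at h₁
    have h₂ := (ENNReal.ofReal_le_ofReal_iff (by positivity)).1 h₁
    refine le_of_sq_le_sq ?_ (by positivity)
    rwa [mul_pow, Real.sq_sqrt ENNReal.toReal_nonneg]
  rw [Metric.tendstoUniformlyOn_iff]
  intro ε hε
  have hq : Continuous q := (withSeminorms_coarseSeminorm d μ n).continuous_seminorm _
  have hq' : Filter.Tendsto (fun β => q β * √(K * μ M).toReal) (𝓝 0) (𝓝 0) := by
    have h : Continuous fun β => q β * √(K * μ M).toReal := hq.mul continuous_const
    simpa only [map_zero, zero_mul] using h.tendsto 0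
  filter_upwards [hq'.eventually_lt_const hε] with β hβ x hx
  rw [ContinuousMap.zero_apply, dist_zero_left]
  exact (hle β x hx).trans_lt hβ

end FromCoarse

/-! ### The smoothed prism operator -/

section SmoothedPrism

variable {G : Type*} [Group G] [TopologicalSpace G] [IsTopologicalGroup G] [T2Space G]
  [LocallyCompactSpace G] [SecondCountableTopology G] [MeasurableSpace G] [BorelSpace G]
  {μ : Measure G} [μ.IsHaarMeasure] {d : G → G → ℝ} {χ : G → ℝ} {n : ℕ}

/-- The prism operator `∑ j, (-1)^j b(x₀, …, xⱼ, xⱼ yⱼ, …, x_{n-1} y_{n-1})`, integrated over `y`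
against the product weight. -/
def smoothedPrism {E : Type*} [NormedAddCommGroup E] [NormedSpace ℝ E] [NormedSpace ℂ E]
    (μ : Measure G) (χ : G → ℝ) (b : (Fin (n + 1) → G) → E) (x : Fin n → G) : E :=
  ∑ j : Fin n, (-1 : ℂ) ^ (j : ℕ) •
    ∫ y, prodWeight χ y • b (prismVertex j x (x * y)) ∂(Measure.pi fun _ => μ)

/-- On cocycles, the smoothed prism operator is a homotopy between smoothing and the identity. -/
theorem IsNormalizedWeight.altSum_smoothedPrism {E : Type*} [NormedAddCommGroup E]
    [NormedSpace ℝ E] [NormedSpace ℂ E] [SMulCommClass ℝ ℂ E] [CompleteSpace E]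
    (hχ : IsNormalizedWeight μ χ)
    {b : (Fin (n + 1) → G) → E} {x : Fin (n + 1) → G}
    (hcocycle : ∀ᵐ y ∂(Measure.pi fun _ : Fin (n + 1) => μ), ∀ j : Fin (n + 1),
      altSum b (prismVertex j x (x * y)) = 0)
    (hint : Integrable (fun y => prodWeight χ y • b (x * y)) (Measure.pi fun _ => μ))
    (hint' : ∀ (i : Fin (n + 1)) (j : Fin n), Integrable (fun y => prodWeight χ y •
      b (prismVertex j (fun k => x (i.succAbove k)) ((fun k => x (i.succAbove k)) * y)))
        (Measure.pi fun _ => μ)) :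
    altSum (smoothedPrism μ χ b) x = smoothing μ χ b x - b x := by
  have hconst : Integrable (fun y : Fin (n + 1) → G => prodWeight χ y • b x)
      (Measure.pi fun _ => μ) :=
    (hχ.continuous_prodWeight.integrable_of_hasCompactSupport
      hχ.hasCompactSupport_prodWeight).smul_const _
  have hR : smoothing μ χ b x - b x =
      ∫ y, prodWeight χ y • (b (x * y) - b x) ∂(Measure.pi fun _ => μ) := by
    simp only [smul_sub]
    rw [integral_sub hint hconst, integral_smul_const, hχ.integral_prodWeight, one_smul, smoothing]
  have hP : ∀ᵐ y ∂(Measure.pi fun _ : Fin (n + 1) => μ), prodWeight χ y • (b (x * y) - b x) =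
      ∑ i : Fin (n + 1), ∑ j : Fin n, (-1 : ℂ) ^ (i : ℕ) • (-1 : ℂ) ^ (j : ℕ) •
        prodWeight χ y • b (prismVertex j (fun k => x (i.succAbove k))
          ((fun k => x (i.succAbove k)) * fun k => y (i.succAbove k))) := by
    filter_upwards [hcocycle] with y hy
    have h₀ : prism (altSum b) x (x * y) = 0 := by
      simp only [prism, hy, smul_zero, Finset.sum_const_zero]
    rw [← altSum_prism_add_prism_altSum, h₀, add_zero]
    simp only [altSum, prism, Finset.smul_sum, smul_comm (prodWeight χ y)]
    rfl
  have hface := fun (i : Fin (n + 1)) (j : Fin n) => hχ.integrable_face i (hint' i j)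
  rw [hR, integral_congr_ae hP]
  simp only [altSum, smoothedPrism, Finset.smul_sum]
  refine Eq.symm ((integral_finsetSum _ fun i _ => integrable_finsetSum _ fun j _ =>
    ((hface i j).smul ((-1 : ℂ) ^ (j : ℕ))).smul ((-1 : ℂ) ^ (i : ℕ))).trans ?_)
  refine Finset.sum_congr rfl fun i _ => ?_
  refine (integral_finsetSum _ fun j _ =>
    ((hface i j).smul ((-1 : ℂ) ^ (j : ℕ))).smul ((-1 : ℂ) ^ (i : ℕ))).trans ?_
  refine Finset.sum_congr rfl fun j _ => ?_
  refine (integral_smul _ _).trans (congrArg _ ((integral_smul _ _).trans (congrArg _ ?_)))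
  exact hχ.integral_face i fun y => b (prismVertex j (fun k => x (i.succAbove k))
    ((fun k => x (i.succAbove k)) * y))

theorem continuous_prismVertex (j : Fin n) :
    Continuous fun p : (Fin n → G) × (Fin n → G) => prismVertex j p.1 (p.1 * p.2) := by
  refine continuous_pi fun k => ?_
  simp only [prismVertex]
  rcases prismIndex j k with i | i
  · exact (continuous_apply i).comp continuous_fst
  · exact (continuous_apply i).comp (continuous_fst.mul continuous_snd)

theorem prismVertex_diagonal_mul (g : G) (j : Fin n) (x y : Fin n → G) :
    prismVertex j (fun k => g * x k) ((fun k => g * x k) * y) =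
      fun k => g * prismVertex j x (x * y) k := by
  funext k
  simp only [prismVertex]
  rcases prismIndex j k with i | i <;> simp [mul_assoc]

end SmoothedPrism

/-! ### The homotopy for continuous cochains -/

section ContinuousHomotopy

variable {G : Type*} [Group G] [TopologicalSpace G] [IsTopologicalGroup G] [T2Space G]
  [LocallyCompactSpace G] [SecondCountableTopology G] [MeasurableSpace G] [BorelSpace G]
  {μ : Measure G} [μ.IsHaarMeasure] {d : G → G → ℝ} {χ : G → ℝ} {n : ℕ}

theorem IsNormalizedWeight.integrable_prodWeight_smul {E ι : Type*} [Fintype ι]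
    [NormedAddCommGroup E] [NormedSpace ℝ E] (hχ : IsNormalizedWeight μ χ) {c : (ι → G) → E}
    (hc : Continuous c) :
    Integrable (fun y => prodWeight χ y • c y) (Measure.pi fun _ => μ) :=
  (hχ.continuous_prodWeight.smul hc).integrable_of_hasCompactSupport
    hχ.hasCompactSupport_prodWeight.smul_right

theorem IsNormalizedWeight.continuous_smoothedPrism {E : Type*} [NormedAddCommGroup E]
    [NormedSpace ℝ E] [NormedSpace ℂ E] (hχ : IsNormalizedWeight μ χ)
    {f : (Fin (n + 1) → G) → E} (hf : Continuous f) : Continuous (smoothedPrism μ χ f) := by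
  refine continuous_finsetSum _ fun j _ => Continuous.const_smul ?_ _
  have h : ∀ x : Fin n → G,
      ∫ y, prodWeight χ y • f (prismVertex j x (x * y)) ∂(Measure.pi fun _ => μ) =
        ∫ y in Set.univ.pi fun _ => tsupport χ,
          prodWeight χ y • f (prismVertex j x (x * y)) ∂(Measure.pi fun _ => μ) := fun x =>
    (setIntegral_eq_integral_of_forall_compl_eq_zero fun y hy => by
      rw [prodWeight_eq_zero hy, zero_smul]).symm
  simp only [h]
  refine continuous_parametric_integral_of_continuous ?_ hχ.isCompact_pi_tsupport
  exact (hχ.continuous_prodWeight.comp continuous_snd).smul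
    (hf.comp (continuous_prismVertex j))

/-- The smoothed prism operator on invariant continuous cochains. -/
def IsNormalizedWeight.continuousHomotopy (hχ : IsNormalizedWeight μ χ)
    (f : continuousCochains (leftRegular μ) (n + 1)) : continuousCochains (leftRegular μ) n :=
  ⟨⟨smoothedPrism μ χ f.1, hχ.continuous_smoothedPrism f.1.continuous⟩, fun g x => by
    let L : Lp ℂ 2 μ →L[ℝ] Lp ℂ 2 μ :=
      (Lp.compMeasurePreservingₗᵢ ℝ _ (measurePreserving_mul_left μ g⁻¹)).toContinuousLinearMap
    have hL : ∀ ξ, leftRegular μ g ξ = L ξ := fun ξ => rfl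
    simp only [ContinuousMap.coe_mk, smoothedPrism, map_sum, map_smul]
    refine Finset.sum_congr rfl fun j _ => ?_
    congr 1
    rw [hL, ← L.integral_comp_comm]
    · refine integral_congr_ae (Filter.Eventually.of_forall fun y => ?_)
      simp only [map_smul]
      rw [prismVertex_diagonal_mul, ← hL, f.2 g]
    · exact hχ.integrable_prodWeight_smul
        (f.1.continuous.comp ((continuous_prismVertex j).comp (.prodMk_right _)))⟩

variable [μ.IsMulRightInvariant]

theorem IsNormalizedWeight.fromCoarse_toCoarse_apply (hχ : IsNormalizedWeight μ χ)
    (hd : IsProperInvariantMetric d) (f : continuousCochains (leftRegular μ) n)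
    (x : Fin (n + 1) → G) :
    (hχ.fromCoarse hd n (toCoarse μ hd n f)).1 x = smoothing μ χ f.1 x := by
  let b : (Fin (n + 1) → G) → ℂ := fun w => (toCoarse μ hd n f).1 w
  have hb : Measurable b := (toCoarse μ hd n f).1.stronglyMeasurable.measurable
  have hk : Continuous fun u => prodWeight χ (x⁻¹ * u) :=
    hχ.continuous_translate.comp (.prodMk_right x)
  have hF : Measurable fun p : (Fin (n + 1) → G) × G =>
      prodWeight χ (x⁻¹ * p.1) • b fun j => p.2⁻¹ * p.1 j :=
    (hk.measurable.comp measurable_fst).smul (hb.comp measurable_inv_diagonal_mul)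
  have hint : Integrable (fun u => prodWeight χ (x⁻¹ * u) • f.1 u) (Measure.pi fun _ => μ) :=
    hχ.integrable_translate_smul f.1.continuous.locallyIntegrable x
  refine Lp.ext ?_
  rw [smoothing_eq]
  refine (hχ.coeFn_orbitMap hd (toCoarse μ hd n f) x).trans ?_
  have h := coeFn_integral_ae hint hF ?_
  · filter_upwards [h] with g hg
    rw [hg, smoothing_inv_diagonal_mul]
  · filter_upwards [corresponds_toCoarse hd f] with u hu
    filter_upwards [hu, Lp.coeFn_smul (prodWeight χ (x⁻¹ * u)) (f.1 u)] with g h₁ h₂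
    rw [h₂, Pi.smul_apply, h₁]

theorem IsNormalizedWeight.fromCoarse_toCoarse_sub_mem (hχ : IsNormalizedWeight μ χ)
    (hd : IsProperInvariantMetric d) {f : continuousCochains (leftRegular μ) n}
    (hf : continuousDifferential (leftRegular μ) n f = 0) :
    hχ.fromCoarse hd n (toCoarse μ hd n f) - f ∈
      coboundaries (continuousDifferential (leftRegular μ)) n := by
  have hf' : ∀ x, altSum f.1 x = 0 := fun x =>
    DFunLike.congr_fun (congrArg Subtype.val hf) x
  have h : ∀ x, altSum (smoothedPrism μ χ f.1) x =
      (hχ.fromCoarse hd n (toCoarse μ hd n f) - f).1 x := by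
    intro x
    refine (hχ.altSum_smoothedPrism (Filter.Eventually.of_forall fun y j => hf' _)
      (hχ.integrable_prodWeight_smul (f.1.continuous.comp (by fun_prop))) fun i j =>
      hχ.integrable_prodWeight_smul
        (f.1.continuous.comp ((continuous_prismVertex j).comp (.prodMk_right _)))).trans ?_
    rw [← hχ.fromCoarse_toCoarse_apply hd]
    rfl
  cases n with
  | zero =>
    refine (Submodule.mem_bot ℂ).2 (Subtype.ext (ContinuousMap.ext fun x => ?_))
    rw [← h]
    simp [altSum, smoothedPrism]
  | succ n => exact ⟨hχ.continuousHomotopy f, Subtype.ext (ContinuousMap.ext h)⟩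

end ContinuousHomotopy

/-! ### The homotopy for coarse cochains -/

section CoarseHomotopy

variable {G : Type*} [Group G] [TopologicalSpace G] [IsTopologicalGroup G] [T2Space G]
  [LocallyCompactSpace G] [SecondCountableTopology G] [MeasurableSpace G] [BorelSpace G]
  {μ : Measure G} [μ.IsHaarMeasure] {d : G → G → ℝ} {χ : G → ℝ} {n : ℕ}

open Classical in
/-- If all entries of `y` stay within distance `R` of one entry with index in the range of `e`, then
the entries with index outside of this range can be integrated out. -/
theorem lintegral_comp_injective_le (hd : IsProperInvariantMetric d) {ι κ : Type*} [Fintype ι]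
    [Fintype κ] {e : ι → κ} (he : Function.Injective e) (i₀ : ι) (R : ℝ)
    {φ : (ι → G) → ℝ≥0∞} (hφ : Measurable φ) :
    ∫⁻ y, {y : κ → G | ∀ k, d (y (e i₀)) (y k) ≤ R}.indicator (fun y => φ fun i => y (e i)) y
        ∂(Measure.pi fun _ => μ) ≤
      (∫⁻ w, φ w ∂(Measure.pi fun _ => μ)) *
        μ (ballOne d R) ^ Fintype.card {k // k ∉ Set.range e} := by
  let T : Set ((ι → G) × ({k // k ∉ Set.range e} → G)) := {p | ∀ k, d (p.1 i₀) (p.2 k) ≤ R}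
  have hT : MeasurableSet T := by
    refine IsClosed.measurableSet ?_
    simp only [T, Set.ofPred_forall]
    refine isClosed_iInter fun k => isClosed_le (hd.continuous.comp
      (f := fun p : (ι → G) × ({k // k ∉ Set.range e} → G) => (p.1 i₀, p.2 k)) (by fun_prop))
      continuous_const
  have hΦ : Measurable (T.indicator fun p => φ p.1) := (hφ.comp measurable_fst).indicator hT
  refine (lintegral_mono (g := fun y => T.indicator (fun p => φ p.1)
    (fun i => y (e i), fun k : {k // k ∉ Set.range e} => y k)) fun y => ?_).trans ?_
  · by_cases hy : ∀ k, d (y (e i₀)) (y k) ≤ R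
    · have hyT : (fun i => y (e i), fun k : {k // k ∉ Set.range e} => y k) ∈ T := fun k => hy k
      simp only [Set.indicator_of_mem hyT]
      exact Set.indicator_le_self _ _ _
    · rw [Set.indicator_of_notMem (by exact hy)]
      exact zero_le
  · rw [(measurePreserving_comp_injective μ he).lintegral_comp hΦ,
      lintegral_prod _ hΦ.aemeasurable, ← lintegral_mul_const _ hφ]
    refine lintegral_mono fun u => ?_
    have h : ∀ v : {k // k ∉ Set.range e} → G, T.indicator (fun p => φ p.1) (u, v) =
        (Set.univ.pi fun _ => {t | d (u i₀) t ≤ R}).indicator (fun _ => φ u) v := by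
      intro v
      simp only [Set.indicator_apply, T]
      congr 1
      simp
    have hball : μ {t | d (u i₀) t ≤ R} = μ (ballOne d R) := by
      rw [← measure_preimage_mul μ (u i₀)⁻¹ (ballOne d R)]
      congr 1
      ext t
      change _ ↔ d 1 ((u i₀)⁻¹ * t) ≤ R
      rw [← hd.left_invariant (u i₀) 1]
      simp
    simp only [h]
    refine (lintegral_indicator_const_le _ _).trans (le_of_eq ?_)
    rw [Measure.pi_pi]
    simp [hball]

theorem lintegral_prismVertex_le (hd : IsProperInvariantMetric d) (j : Fin (n + 1)) (R : ℝ)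
    {φ : (Fin (n + 2) → G) → ℝ≥0∞} (hφ : Measurable φ)
    {A : Set ((Fin (n + 1) → G) × (Fin (n + 1) → G))}
    (hA : ∀ p ∈ A, ∀ k, d (p.1 0) (p.1 k) ≤ R ∧ d (p.1 0) (p.2 k) ≤ R) :
    ∃ c : ℝ≥0∞, c ≠ ∞ ∧
      ∫⁻ p, A.indicator (fun p => φ (prismVertex j p.1 p.2)) p
        ∂((Measure.pi fun _ => μ).prod (Measure.pi fun _ => μ)) ≤
      (∫⁻ w, φ w ∂(Measure.pi fun _ => μ)) * c := by
  classical
  refine ⟨_, ENNReal.pow_ne_top (hd.measure_ballOne_lt_top R).ne, le_trans ?_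
    (lintegral_comp_injective_le (μ := μ) hd (prismIndex_injective j) 0 R hφ)⟩
  rw [← (measurePreserving_sumPiEquivProdPi
    (fun _ : Fin (n + 1) ⊕ Fin (n + 1) => μ)).symm.lintegral_comp_emb
      (MeasurableEquiv.measurableEmbedding _)]
  refine lintegral_mono fun p => ?_
  by_cases hp : p ∈ A
  · rw [Set.indicator_of_mem hp, Set.indicator_of_mem]
    · refine le_of_eq (congrArg φ (funext fun i => ?_))
      simp only [prismVertex]
      rcases prismIndex j i with k | k <;> rfl
    · intro k
      rw [prismIndex_apply_zero]
      rcases k with k | k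
      · exact (hA p hp k).1
      · exact (hA p hp k).2
  · rw [Set.indicator_of_notMem hp]
    exact zero_le

theorem quasiMeasurePreserving_prismVertex (j : Fin n) :
    Measure.QuasiMeasurePreserving
      (fun p : (Fin n → G) × (Fin n → G) => prismVertex j p.1 (p.1 * p.2))
      ((Measure.pi fun _ => μ).prod (Measure.pi fun _ => μ)) (Measure.pi fun _ => μ) := by
  have h₁ := quasiMeasurePreserving_comp_injective μ (prismIndex_injective j)
  have h₂ := (measurePreserving_sumPiEquivProdPi
    (fun _ : Fin n ⊕ Fin n => μ)).symm.quasiMeasurePreserving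
  have h₃ := (measurePreserving_prod_mul (Measure.pi fun _ : Fin n => μ)
    (Measure.pi fun _ : Fin n => μ)).quasiMeasurePreserving
  convert h₁.comp (h₂.comp h₃) using 1
  funext p i
  simp only [prismVertex, Function.comp]
  rcases prismIndex j i with k | k <;> rfl

theorem IsNormalizedWeight.setLIntegral_prismVertex_lt_top (hχ : IsNormalizedWeight μ χ)
    (hd : IsProperInvariantMetric d) (α : CoarseCochains d μ (n + 1)) (j : Fin (n + 1)) {R : ℝ}
    (hR : 0 < R) :
    ∫⁻ x in controlled d (n + 1) R, ∫⁻ y in Set.univ.pi fun _ => tsupport χ,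
      ‖α.1 (prismVertex j x (x * y))‖ₑ ^ 2 ∂(Measure.pi fun _ => μ) ∂(Measure.pi fun _ => μ)
        < ∞ := by
  have hα : Measurable α.1 := α.1.stronglyMeasurable.measurable
  obtain ⟨r, hr, hχr⟩ := hd.exists_bound (hχ.hasCompactSupport.insert 1)
  -- the distance between two vertices of the prisms in question is at most `R + 2 r`
  set R' := R + 2 * r
  have hR' : 0 < R' := by positivity
  let A : Set ((Fin (n + 1) → G) × (Fin (n + 1) → G)) :=
    {p | p.1 ∈ controlled d (n + 1) R ∧ ∀ k, d (p.1 k) (p.2 k) ≤ r}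
  have hAm : MeasurableSet A := by
    have h : IsClosed {p : (Fin (n + 1) → G) × (Fin (n + 1) → G) | ∀ k, d (p.1 k) (p.2 k) ≤ r} := by
      simp only [Set.ofPred_forall]
      exact isClosed_iInter fun k => isClosed_le (hd.continuous.comp
        (f := fun p : (Fin (n + 1) → G) × (Fin (n + 1) → G) => (p.1 k, p.2 k)) (by fun_prop))
        continuous_const
    exact (measurable_fst (measurableSet_controlled hd (n + 1) R)).inter h.measurableSet
  have hdist : ∀ p ∈ A, ∀ k l, d (Sum.elim p.1 p.2 k) (Sum.elim p.1 p.2 l) ≤ R' := by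
    intro p hp
    have h₁ : ∀ k l, d (p.1 k) (p.2 l) ≤ R + r := fun k l =>
      (hd.triangle _ (p.1 l) _).trans (add_le_add (hp.1 k l) (hp.2 l))
    have h₂ : ∀ k l, d (p.2 k) (p.2 l) ≤ R + 2 * r := fun k l => by
      have h := hd.triangle (p.2 k) (p.1 k) (p.2 l)
      rw [hd.symm (p.2 k) (p.1 k)] at h
      linarith [hp.2 k, h₁ k l]
    rintro (k | k) (l | l)
    · exact (hp.1 k l).trans (by simp only [R']; linarith)
    · exact (h₁ k l).trans (by simp only [R']; linarith)
    · rw [hd.symm]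
      exact (h₁ l k).trans (by simp only [R']; linarith)
    · exact h₂ k l
  let φ : (Fin (n + 2) → G) → ℝ≥0∞ :=
    (controlled d (n + 2) R').indicator fun w => ‖α.1 w‖ₑ ^ 2
  have hφ : Measurable φ := (hα.enorm.pow_const 2).indicator (measurableSet_controlled hd _ _)
  obtain ⟨c, hc, hle⟩ := lintegral_prismVertex_le (μ := μ) hd j R' hφ (A := A)
    (fun p hp k => ⟨hdist p hp (.inl 0) (.inl k), hdist p hp (.inl 0) (.inr k)⟩)
  have hφ' : ∫⁻ w, φ w ∂(Measure.pi fun _ => μ) < ∞ := by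
    rw [lintegral_indicator (measurableSet_controlled hd _ _),
      ← coarseSeminorm_sq d μ (n + 1) ⟨R', hR'⟩]
    simp
  refine lt_of_le_of_lt ?_ (hle.trans_lt (ENNReal.mul_lt_top hφ' hc.lt_top))
  have hpv : Measurable fun p : (Fin (n + 1) → G) × (Fin (n + 1) → G) =>
      prismVertex j p.1 p.2 := by
    refine measurable_pi_iff.2 fun i => ?_
    simp only [prismVertex]
    rcases prismIndex j i with k | k
    · exact (measurable_pi_apply k).comp measurable_fst
    · exact (measurable_pi_apply k).comp measurable_snd
  have hΨ : Measurable (A.indicator fun p => φ (prismVertex j p.1 p.2)) :=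
    (hφ.comp hpv).indicator hAm
  refine le_of_le_of_eq ?_ ((measurePreserving_prod_mul (Measure.pi fun _ : Fin (n + 1) => μ)
    (Measure.pi fun _ => μ)).lintegral_comp hΨ)
  have hΨ' : Measurable fun p : (Fin (n + 1) → G) × (Fin (n + 1) → G) =>
      A.indicator (fun p => φ (prismVertex j p.1 p.2)) (p.1, p.1 * p.2) := hΨ.comp (by fun_prop)
  rw [lintegral_prod _ hΨ'.aemeasurable, ← lintegral_indicator (measurableSet_controlled hd _ _)]
  refine lintegral_mono fun x => ?_
  by_cases hx : x ∈ controlled d (n + 1) R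
  · rw [Set.indicator_of_mem hx,
      ← lintegral_indicator hχ.isCompact_pi_tsupport.measurableSet]
    refine lintegral_mono fun y => ?_
    by_cases hy : y ∈ Set.univ.pi fun _ => tsupport χ
    · have hp : (x, x * y) ∈ A := by
        refine ⟨hx, fun k => ?_⟩
        have h := hχr 1 (Set.mem_insert _ _) (y k) (Set.mem_insert_of_mem _ (hy k (Set.mem_univ _)))
        rwa [← hd.left_invariant (x k), mul_one] at h
      rw [Set.indicator_of_mem hy, Set.indicator_of_mem hp]
      simp only [φ]
      rw [Set.indicator_of_mem]
      exact fun k l => hdist _ hp _ _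
    · rw [Set.indicator_of_notMem hy]
      exact zero_le
  · rw [Set.indicator_of_notMem hx]
    exact zero_le

theorem measurable_prismVertex_coarse (α : CoarseCochains d μ n) (j : Fin n) :
    Measurable fun p : (Fin n → G) × (Fin n → G) => α.1 (prismVertex j p.1 (p.1 * p.2)) :=
  α.1.stronglyMeasurable.measurable.comp (continuous_prismVertex j).measurable

theorem IsNormalizedWeight.lintegral_sq_prodWeight_lt_top (hχ : IsNormalizedWeight μ χ) :
    ∫⁻ y in Set.univ.pi fun _ => tsupport χ, ‖prodWeight χ y‖ₑ ^ 2
      ∂(Measure.pi fun _ : Fin n => μ) < ∞ := by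
  refine (setLIntegral_le_lintegral _ _).trans_lt ?_
  have h := hχ.continuous_prodWeight (ι := Fin n).memLp_of_hasCompactSupport
    (μ := Measure.pi fun _ => μ) (p := 2) hχ.hasCompactSupport_prodWeight
  have h' := ENNReal.pow_lt_top h.2 (n := 2)
  rwa [eLpNorm_two_sq] at h'

theorem IsNormalizedWeight.stronglyMeasurable_integral_prismVertex (hχ : IsNormalizedWeight μ χ)
    (α : CoarseCochains d μ n) (j : Fin n) :
    StronglyMeasurable fun x : Fin n → G =>
      ∫ y, prodWeight χ y • α.1 (prismVertex j x (x * y)) ∂(Measure.pi fun _ => μ) := by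
  have h : Measurable fun p : (Fin n → G) × (Fin n → G) =>
      prodWeight χ p.2 • α.1 (prismVertex j p.1 (p.1 * p.2)) :=
    (hχ.continuous_prodWeight.measurable.comp measurable_snd).smul
      (measurable_prismVertex_coarse α j)
  exact h.stronglyMeasurable.integral_prod_right

theorem IsNormalizedWeight.memLp_smoothedPrism (hχ : IsNormalizedWeight μ χ)
    (hd : IsProperInvariantMetric d) (α : CoarseCochains d μ (n + 1)) {R : ℝ} (hR : 0 < R) :
    MemLp (smoothedPrism μ χ α.1) 2
      ((Measure.pi fun _ => μ).restrict (controlled d (n + 1) R)) := by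
  suffices h : ∀ j : Fin (n + 1), MemLp (fun x : Fin (n + 1) → G =>
      ∫ y, prodWeight χ y • α.1 (prismVertex j x (x * y)) ∂(Measure.pi fun _ => μ)) 2
        ((Measure.pi fun _ => μ).restrict (controlled d (n + 1) R)) from
    memLp_finsetSum _ fun j _ => (h j).const_smul ((-1 : ℂ) ^ (j : ℕ))
  intro j
  refine ⟨(hχ.stronglyMeasurable_integral_prismVertex α j).aestronglyMeasurable, ?_⟩
  suffices h : eLpNorm _ 2 _ ^ 2 < ∞ from (ENNReal.pow_lt_top_iff.1 h).resolve_right two_ne_zero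
  rw [eLpNorm_two_sq]
  have hmeas : Measurable fun x => ∫⁻ y in Set.univ.pi fun _ => tsupport χ,
      ‖α.1 (prismVertex j x (x * y))‖ₑ ^ 2 ∂(Measure.pi fun _ => μ) :=
    ((measurable_prismVertex_coarse α j).enorm.pow_const 2).lintegral_prod_right'
  refine (lintegral_mono fun x => sq_enorm_integral_smul_le
    hχ.continuous_prodWeight.measurable.aemeasurable
    ((measurable_prismVertex_coarse α j).comp measurable_prodMk_left).aestronglyMeasurable
    fun y hy => prodWeight_eq_zero hy).trans_lt ?_
  refine (lintegral_const_mul _ hmeas).trans_lt ?_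
  exact ENNReal.mul_lt_top hχ.lintegral_sq_prodWeight_lt_top
    (hχ.setLIntegral_prismVertex_lt_top hd α j hR)

/-- The smoothed prism operator on coarse cochains. -/
def IsNormalizedWeight.coarseHomotopy (hχ : IsNormalizedWeight μ χ)
    (hd : IsProperInvariantMetric d) (α : CoarseCochains d μ (n + 1)) : CoarseCochains d μ n :=
  have h : AEStronglyMeasurable (smoothedPrism μ χ α.1) (Measure.pi fun _ : Fin (n + 1) => μ) :=
    (Finset.stronglyMeasurable_fun_sum Finset.univ fun j _ =>
      (hχ.stronglyMeasurable_integral_prismVertex α j).const_smul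
        ((-1 : ℂ) ^ (j : ℕ))).aestronglyMeasurable
  ⟨AEEqFun.mk (smoothedPrism μ χ α.1) h, fun R hR => by
    rw [eLpNorm_congr_ae (ae_restrict_of_ae (AEEqFun.coeFn_mk _ h))]
    exact (hχ.memLp_smoothedPrism hd α hR).2⟩

theorem IsNormalizedWeight.coeFn_coarseHomotopy (hχ : IsNormalizedWeight μ χ)
    (hd : IsProperInvariantMetric d) (α : CoarseCochains d μ (n + 1)) :
    (hχ.coarseHomotopy hd α).1 =ᵐ[Measure.pi fun _ => μ] smoothedPrism μ χ α.1 :=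
  AEEqFun.coeFn_mk _ _

theorem IsNormalizedWeight.ae_integrable_prismVertex (hχ : IsNormalizedWeight μ χ)
    (hd : IsProperInvariantMetric d) (α : CoarseCochains d μ n) (j : Fin n) :
    ∀ᵐ x ∂(Measure.pi fun _ : Fin n => μ),
      Integrable (fun y => prodWeight χ y • α.1 (prismVertex j x (x * y)))
        (Measure.pi fun _ => μ) := by
  cases n with
  | zero => exact j.elim0
  | succ n =>
  have hmeas : Measurable fun x => ∫⁻ y in Set.univ.pi fun _ => tsupport χ,
      ‖α.1 (prismVertex j x (x * y))‖ₑ ^ 2 ∂(Measure.pi fun _ => μ) :=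
    ((measurable_prismVertex_coarse α j).enorm.pow_const 2).lintegral_prod_right'
  have h : ∀ᵐ x ∂(Measure.pi fun _ : Fin (n + 1) => μ), ∀ N : ℕ,
      x ∈ controlled d (n + 1) ((N : ℝ) + 1) →
      ∫⁻ y in Set.univ.pi fun _ => tsupport χ,
        ‖α.1 (prismVertex j x (x * y))‖ₑ ^ 2 ∂(Measure.pi fun _ => μ) < ∞ :=
    ae_all_iff.2 fun N => (ae_restrict_iff' (measurableSet_controlled hd _ _)).1
      (ae_lt_top hmeas (hχ.setLIntegral_prismVertex_lt_top hd α j (by positivity)).ne)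
  filter_upwards [h] with x hx
  obtain ⟨C, hC⟩ := (Set.finite_range fun p : Fin (n + 1) × Fin (n + 1) =>
    d (x p.1) (x p.2)).bddAbove
  obtain ⟨N, hN⟩ := exists_nat_ge C
  have hfin := hx N fun k l => (hC ⟨(k, l), rfl⟩).trans (by linarith)
  set T : Set (Fin (n + 1) → G) := Set.univ.pi fun _ => tsupport χ
  have hT : IsCompact T := hχ.isCompact_pi_tsupport
  have hm : Measurable fun y => α.1 (prismVertex j x (x * y)) :=
    (measurable_prismVertex_coarse α j).comp measurable_prodMk_left
  have hL2 : MemLp (fun y => α.1 (prismVertex j x (x * y))) 2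
      ((Measure.pi fun _ => μ).restrict T) := by
    refine ⟨hm.aestronglyMeasurable, ?_⟩
    rw [← eLpNorm_two_sq] at hfin
    exact (ENNReal.pow_lt_top_iff.1 hfin).resolve_right two_ne_zero
  have hw : MemLp (fun y : Fin (n + 1) → G => prodWeight χ y) 2
      ((Measure.pi fun _ => μ).restrict T) :=
    (hχ.continuous_prodWeight.memLp_of_hasCompactSupport
      hχ.hasCompactSupport_prodWeight).restrict _
  have hint := memLp_one_iff_integrable.1 (hL2.smul hw (r := 1))
  refine (integrableOn_iff_integrable_of_support_subset fun y hy => ?_).1 hint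
  by_contra hyT
  exact hy (by simp [prodWeight_eq_zero hyT])

variable [μ.IsMulRightInvariant]

theorem IsNormalizedWeight.coeFn_toCoarse_fromCoarse (hχ : IsNormalizedWeight μ χ)
    (hd : IsProperInvariantMetric d) (β : CoarseCochains d μ n) :
    (toCoarse μ hd n (hχ.fromCoarse hd n β)).1 =ᵐ[Measure.pi fun _ => μ]
      smoothing μ χ β.1 := by
  have hβ : Measurable β.1 := β.1.stronglyMeasurable.measurable
  have hm : Measurable fun p : (Fin (n + 1) → G) × (Fin (n + 1) → G) =>
      prodWeight χ p.2 • β.1 (p.1 * p.2) :=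
    (hχ.continuous_prodWeight.measurable.comp measurable_snd).smul (hβ.comp (by fun_prop))
  have hs : Measurable (smoothing μ χ β.1) :=
    (hm.stronglyMeasurable.integral_prod_right (ν := Measure.pi fun _ => μ)).measurable
  refine ae_of_ae_ae_inv_diagonal_mul (measurableSet_eq_fun
    (toCoarse μ hd n (hχ.fromCoarse hd n β)).1.stronglyMeasurable.measurable hs) ?_
  filter_upwards [corresponds_toCoarse hd (hχ.fromCoarse hd n β)] with x hx
  filter_upwards [hx, hχ.coeFn_orbitMap hd β x] with g h₁ h₂
  rw [← h₁]
  exact h₂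

theorem IsNormalizedWeight.toCoarse_fromCoarse_sub_mem (hχ : IsNormalizedWeight μ χ)
    (hd : IsProperInvariantMetric d) {β : CoarseCochains d μ n}
    (hβ : coarseDifferential μ hd n β = 0) :
    toCoarse μ hd n (hχ.fromCoarse hd n β) - β ∈ coboundaries (coarseDifferential μ hd) n := by
  have hcocycle : ∀ᵐ w ∂(Measure.pi fun _ : Fin (n + 2) => μ), altSum β.1 w = 0 := by
    have h₀ : (coarseDifferential μ hd n β).1 = 0 := congrArg Subtype.val hβ
    filter_upwards [coeFn_coarseDifferential hd β, AEEqFun.coeFn_zero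
      (μ := Measure.pi fun _ : Fin (n + 2) => μ) (β := ℂ)] with w h₁ h₂
    rw [← h₁, h₀, h₂, Pi.zero_apply]
  have h₁ : ∀ᵐ x ∂(Measure.pi fun _ : Fin (n + 1) => μ),
      ∀ᵐ y ∂(Measure.pi fun _ : Fin (n + 1) => μ), ∀ j : Fin (n + 1),
        altSum β.1 (prismVertex j x (x * y)) = 0 :=
    Measure.ae_ae_of_ae_prod (ae_all_iff.2 fun j =>
      (quasiMeasurePreserving_prismVertex j).ae hcocycle)
  have h₂ : ∀ᵐ x ∂(Measure.pi fun _ : Fin (n + 1) => μ), ∀ (i : Fin (n + 1)) (j : Fin n),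
      Integrable (fun y => prodWeight χ y •
        β.1 (prismVertex j (fun k => x (i.succAbove k)) ((fun k => x (i.succAbove k)) * y)))
          (Measure.pi fun _ => μ) :=
    ae_all_iff.2 fun i => ae_all_iff.2 fun j =>
      (quasiMeasurePreserving_comp_injective μ i.succAbove_right_injective).ae
        (hχ.ae_integrable_prismVertex hd β j)
  have h : (toCoarse μ hd n (hχ.fromCoarse hd n β) - β).1 =ᵐ[Measure.pi fun _ => μ]
      altSum (smoothedPrism μ χ β.1) := by
    have hsub : (toCoarse μ hd n (hχ.fromCoarse hd n β) - β).1 =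
      (toCoarse μ hd n (hχ.fromCoarse hd n β)).1 - β.1 := rfl
    rw [hsub]
    filter_upwards [h₁, h₂, AEEqFun.coeFn_sub (toCoarse μ hd n (hχ.fromCoarse hd n β)).1 β.1,
      hχ.coeFn_toCoarse_fromCoarse hd β] with x hx₁ hx₂ hx₃ hx₄
    rw [hx₃, Pi.sub_apply, hx₄, hχ.altSum_smoothedPrism hx₁
      (hχ.integrable_smoothing (locallyIntegrable_coarse hd β) x) hx₂]
  cases n with
  | zero =>
    refine (Submodule.mem_bot ℂ).2 (Subtype.ext (AEEqFun.ext (h.trans ?_)))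
    refine Filter.EventuallyEq.trans (Filter.Eventually.of_forall fun x => ?_)
      AEEqFun.coeFn_zero.symm
    simp [altSum, smoothedPrism]
  | succ n =>
    refine ⟨hχ.coarseHomotopy hd β, Subtype.ext (AEEqFun.ext ?_)⟩
    refine (coeFn_coarseDifferential hd _).trans (Filter.EventuallyEq.trans ?_ h.symm)
    have hface : ∀ᵐ x ∂(Measure.pi fun _ : Fin (n + 2) => μ), ∀ i : Fin (n + 2),
        (hχ.coarseHomotopy hd β).1 (fun k => x (i.succAbove k)) =
          smoothedPrism μ χ β.1 fun k => x (i.succAbove k) :=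
      ae_all_iff.2 fun i => (quasiMeasurePreserving_comp_injective μ
        i.succAbove_right_injective).ae (hχ.coeFn_coarseHomotopy hd β)
    filter_upwards [hface] with x hx
    simp only [altSum, hx]

end CoarseHomotopy

/-! ### Comparison of cohomology -/

section Comparison

variable {A B : ℕ → Type*} [∀ n, AddCommGroup (A n)] [∀ n, Module ℂ (A n)]
  [∀ n, AddCommGroup (B n)] [∀ n, Module ℂ (B n)]

/-- A linear map that respects two submodules `P` and `Q`, and is invertible up to `P` and `Q`,
induces an isomorphism of the quotients. -/
theorem exists_quotient_equiv {M N : Type*} [AddCommGroup M] [Module ℂ M] [AddCommGroup N]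
    [Module ℂ N] {P : Submodule ℂ M} {Q : Submodule ℂ N} (u : M →ₗ[ℂ] N) (v : N →ₗ[ℂ] M)
    (hu : P ≤ Q.comap u) (hv : Q ≤ P.comap v) (hvu : ∀ x, v (u x) - x ∈ P)
    (huv : ∀ y, u (v y) - y ∈ Q) :
    ∃ Φ : (M ⧸ P) ≃ₗ[ℂ] N ⧸ Q, ∀ x, Φ (P.mkQ x) = Q.mkQ (u x) := by
  refine ⟨LinearEquiv.ofLinearMap (P.mapQ Q u hu) (Q.mapQ P v hv) ?_ ?_, fun x => rfl⟩
  · refine Submodule.linearMap_qext _ (LinearMap.ext fun y => ?_)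
    exact (Submodule.Quotient.eq Q).2 (huv y)
  · refine Submodule.linearMap_qext _ (LinearMap.ext fun x => ?_)
    exact (Submodule.Quotient.eq P).2 (hvu x)

theorem map_coboundaries_le {δ : ∀ n, A n →ₗ[ℂ] A (n + 1)} {ε : ∀ n, B n →ₗ[ℂ] B (n + 1)}
    (u : ∀ n, A n →ₗ[ℂ] B n) (hu : ∀ n x, u (n + 1) (δ n x) = ε n (u n x)) (n : ℕ) :
    coboundaries δ n ≤ (coboundaries ε n).comap (u n) := by
  cases n with
  | zero => exact bot_le
  | succ n =>
    rintro _ ⟨x, rfl⟩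
    exact ⟨u n x, (hu n x).symm⟩

/-- The restriction of a chain map to cocycles. -/
def cocyclesMap {δ : ∀ n, A n →ₗ[ℂ] A (n + 1)} {ε : ∀ n, B n →ₗ[ℂ] B (n + 1)}
    (u : ∀ n, A n →ₗ[ℂ] B n) (hu : ∀ n x, u (n + 1) (δ n x) = ε n (u n x)) (n : ℕ) :
    cocycles δ n →ₗ[ℂ] cocycles ε n :=
  (u n).restrict fun x hx => by
    rw [LinearMap.mem_ker] at hx ⊢
    rw [← hu, hx, map_zero]

theorem cocyclesMap_coe {δ : ∀ n, A n →ₗ[ℂ] A (n + 1)} {ε : ∀ n, B n →ₗ[ℂ] B (n + 1)}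
    (u : ∀ n, A n →ₗ[ℂ] B n) (hu : ∀ n x, u (n + 1) (δ n x) = ε n (u n x)) (n : ℕ)
    (x : cocycles δ n) : (cocyclesMap u hu n x).1 = u n x.1 := rfl

theorem map_closure_le {M N : Type*} [AddCommGroup M] [Module ℂ M] [AddCommGroup N] [Module ℂ N]
    [TopologicalSpace M] [IsTopologicalAddGroup M] [ContinuousConstSMul ℂ M] [TopologicalSpace N]
    [IsTopologicalAddGroup N] [ContinuousConstSMul ℂ N] {P : Submodule ℂ M} {Q : Submodule ℂ N}
    {u : M →ₗ[ℂ] N} (hu : P ≤ Q.comap u) (hcont : Continuous u) :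
    P.topologicalClosure ≤ Q.topologicalClosure.comap u := fun _ hx =>
  map_mem_closure hcont hx fun _ hy => hu hy

/-- Chain maps that are inverse to each other on cocycles, up to coboundaries, induce isomorphisms
in cohomology. -/
theorem exists_cohomology_equiv {δ : ∀ n, A n →ₗ[ℂ] A (n + 1)} {ε : ∀ n, B n →ₗ[ℂ] B (n + 1)}
    (u : ∀ n, A n →ₗ[ℂ] B n) (hu : ∀ n x, u (n + 1) (δ n x) = ε n (u n x))
    (v : ∀ n, B n →ₗ[ℂ] A n) (hv : ∀ n x, v (n + 1) (ε n x) = δ n (v n x)) (n : ℕ)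
    (hvu : ∀ x, δ n x = 0 → v n (u n x) - x ∈ coboundaries δ n)
    (huv : ∀ y, ε n y = 0 → u n (v n y) - y ∈ coboundaries ε n) :
    ∃ Φ : Cohomology δ n ≃ₗ[ℂ] Cohomology ε n, ∀ x : cocycles δ n,
      Φ (Submodule.mkQ _ x) = Submodule.mkQ _ (cocyclesMap u hu n x) :=
  exists_quotient_equiv (cocyclesMap u hu n) (cocyclesMap v hv n)
    (fun _ hx => map_coboundaries_le u hu n hx) (fun _ hy => map_coboundaries_le v hv n hy)
    (fun x => hvu x.1 x.2) (fun y => huv y.1 y.2)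

/-- Continuous chain maps that are inverse to each other on cocycles, up to coboundaries, induce
isomorphisms in reduced cohomology. -/
theorem exists_reducedCohomology_equiv [∀ n, TopologicalSpace (A n)]
    [∀ n, IsTopologicalAddGroup (A n)] [∀ n, ContinuousConstSMul ℂ (A n)]
    [∀ n, TopologicalSpace (B n)] [∀ n, IsTopologicalAddGroup (B n)]
    [∀ n, ContinuousConstSMul ℂ (B n)]
    {δ : ∀ n, A n →ₗ[ℂ] A (n + 1)} {ε : ∀ n, B n →ₗ[ℂ] B (n + 1)}
    (u : ∀ n, A n →ₗ[ℂ] B n) (hu : ∀ n x, u (n + 1) (δ n x) = ε n (u n x))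
    (v : ∀ n, B n →ₗ[ℂ] A n) (hv : ∀ n x, v (n + 1) (ε n x) = δ n (v n x)) (n : ℕ)
    (hvu : ∀ x, δ n x = 0 → v n (u n x) - x ∈ coboundaries δ n)
    (huv : ∀ y, ε n y = 0 → u n (v n y) - y ∈ coboundaries ε n)
    (hucont : Continuous (u n)) (hvcont : Continuous (v n)) :
    ∃ Φ : ReducedCohomology δ n ≃ₗ[ℂ] ReducedCohomology ε n, ∀ x : cocycles δ n,
      Φ (Submodule.mkQ _ x) = Submodule.mkQ _ (cocyclesMap u hu n x) :=
  exists_quotient_equiv (cocyclesMap u hu n) (cocyclesMap v hv n)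
    (fun _ hx => map_closure_le (map_coboundaries_le u hu n) hucont hx)
    (fun _ hy => map_closure_le (map_coboundaries_le v hv n) hvcont hy)
    (fun x => Submodule.le_topologicalClosure _ (hvu x.1 x.2))
    (fun y => Submodule.le_topologicalClosure _ (huv y.1 y.2))

end Comparison

theorem corresponds_of_eq_toCoarse {G : Type*} [Group G] [TopologicalSpace G]
    [IsTopologicalGroup G] [LocallyCompactSpace G] [SecondCountableTopology G]
    [MeasurableSpace G] [BorelSpace G] {μ : Measure G} [μ.IsHaarMeasure] [μ.IsMulRightInvariant]
    {d : G → G → ℝ} (hd : IsProperInvariantMetric d) {n : ℕ}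
    (f : continuousCochains (leftRegular μ) n) {β : CoarseCochains d μ n}
    (h : β = toCoarse μ hd n f) : Corresponds f.1 β.1 := by
  rw [h]
  exact corresponds_toCoarse hd f

end CoarseL2

end

open CoarseL2
theorem theorem3p2 {G : Type*} [Group G] [TopologicalSpace G] [IsTopologicalGroup G]
    [T2Space G] [LocallyCompactSpace G] [SecondCountableTopology G]
    [MeasurableSpace G] [BorelSpace G]
    (μ : Measure G) [μ.IsHaarMeasure] [μ.IsMulRightInvariant]
    (d : G → G → ℝ) (hd : IsProperInvariantMetric d) (n : ℕ) :
    (∃ Φ : ContinuousCohomology (leftRegular μ) n ≃ₗ[ℂ] CoarseCohomology μ hd n,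
      ∀ f : ContinuousCocycles (leftRegular μ) n,
        ∃ β : CoarseCocycles μ hd n, Corresponds f.1.1 β.1.1 ∧
          Φ (Submodule.mkQ _ f) = Submodule.mkQ _ β) ∧
    (∃ Φ : ReducedContinuousCohomology (leftRegular μ) n ≃ₗ[ℂ] ReducedCoarseCohomology μ hd n,
      ∀ f : ContinuousCocycles (leftRegular μ) n,
        ∃ β : CoarseCocycles μ hd n, Corresponds f.1.1 β.1.1 ∧
          Φ (Submodule.mkQ _ f) = Submodule.mkQ _ β) := by
  have hχ := (exists_isNormalizedWeight μ).choose_spec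
  have hu : ∀ n f, toCoarse μ hd (n + 1) (continuousDifferential (leftRegular μ) n f) =
      coarseDifferential μ hd n (toCoarse μ hd n f) := fun _ f => toCoarse_differential hd f
  have hcorr (f : ContinuousCocycles (leftRegular μ) n) : Corresponds f.1.1
      (cocyclesMap (δ := continuousDifferential (leftRegular μ)) (ε := coarseDifferential μ hd)
        (toCoarse μ hd) hu n f).1.1 :=
    corresponds_of_eq_toCoarse hd f.1 (cocyclesMap_coe _ _ _ _)
  have h₁ := exists_cohomology_equiv (δ := continuousDifferential (leftRegular μ))
    (ε := coarseDifferential μ hd) (toCoarse μ hd) hu (hχ.fromCoarse hd)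
    (fun _ β => hχ.fromCoarse_differential hd β) n
    (fun _ hf => hχ.fromCoarse_toCoarse_sub_mem hd hf)
    (fun _ hβ => hχ.toCoarse_fromCoarse_sub_mem hd hβ)
  have h₂ := exists_reducedCohomology_equiv (δ := continuousDifferential (leftRegular μ))
    (ε := coarseDifferential μ hd) (toCoarse μ hd) hu (hχ.fromCoarse hd)
    (fun _ β => hχ.fromCoarse_differential hd β) n
    (fun _ hf => hχ.fromCoarse_toCoarse_sub_mem hd hf)
    (fun _ hβ => hχ.toCoarse_fromCoarse_sub_mem hd hβ)
    (continuous_toCoarse hd n) (hχ.continuous_fromCoarse hd n)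
  exact ⟨h₁.imp fun Φ hΦ f => ⟨_, hcorr f, hΦ f⟩, h₂.imp fun Φ hΦ f => ⟨_, hcorr f, hΦ f⟩⟩
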